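/- **Setting.** Indices $1,2,1'$ ($=3$) with $i'=4-i$ have parities $\bar 1=\bar 1'=1$, $\bar 2=0$, and $\theta_1=\theta_2=1$, $\theta_{1'}=-1$. Let $e_{ij}$ be the matrix units of the superalgebra $\operatorname{End}\mathbb C^{1|2}$ (of parity $\bar\imath+\bar\jmath$), $P=\sum e_{ij}\otimes e_{ji}(-1)^{\bar\jmath}$, $Q=\sum e_{ij}\otimes e_{i'j'}(-1)^{\bar\imath\bar\jmath}\theta_i\theta_j$ and $$R(u)=1-\frac{P}{u}+\frac{Q}{u-\kappa},\qquad \kappa=-\tfrac32 .$$ The extended Yangian $\mathrm X(\mathfrak{osp}_{1|2})$ is the superalgebra over $\mathbb C$ with generators $t_{ij}^{(r)}$, $r\ge 1$, of parity $\bar\imath+\bar\jmath$, and defining relations $R(u-v)T_1(u)T_2(v)=T_2(v)T_1(u)R(u-v)$, where $t_{ij}(u)=\delta_{ij}+\sum_{r\ge1}t_{ij}^{(r)}u^{-r}$ and $T(u)=\sum e_{ij}\otimes t_{ij}(u)(-1)^{\bar\imath\bar\jmath+\bar\jmath}$. The Yangian $\mathrm Y(\mathfrak{osp}_{1|2})$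 is the subalgebra of elements stable under all automorphisms $t_{ij}(u)\mapsto\varphi(u)t_{ij}(u)$ with $\varphi(u)\in 1+u^{-1}\mathbb C[[u^{-1}]]$. The coproduct $\Delta:t_{ij}(u)\mapsto\sum_k t_{ik}(u)\otimes t_{kj}(u)$ of $\mathrm X(\mathfrak{osp}_{1|2})$ restricts to a homomorphism $\Delta:\mathrm Y(\mathfrak{osp}_{1|2})\to \mathrm Y(\mathfrak{osp}_{1|2})\otimes \mathrm Y(\mathfrak{osp}_{1|2})$, where tensor products are those of superalgebras: $(a\otimes b)(a'\otimes b')=(-1)^{p(b)p(a')}aa'\otimes bb'$. Put $$h_1(u)=t_{11}(u),\quad h_2(u)=t_{22}(u)-t_{21}(u)t_{11}(u)^{-1}t_{12}(u),\quad k(u)=h_1(u)^{-1}h_2(u),$$ $$e(u)=h_1(u)^{-1}t_{12}(u),\quad e_{11'}(u)=h_1(u)^{-1}t_{11'}(u),\quad f(u)=t_{21}(u)h_1(u)^{-1},\quad f_{1'1}(u)=t_{1'1}(u)h_1(u)^{-1}.$$ The coefficients of $k,e,e_{11'},f,f_{1'1}$ lie in $\mathrm Y(\mathfrak{osp}_{1|2})$;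 shifted series such as $f(u+1)$ are expanded in powers of $u^{-1}$. **Proposition.** In $\big(\mathrm Y(\mathfrak{osp}_{1|2})\otimes\mathrm Y(\mathfrak{osp}_{1|2})\big)[[u^{-1}]]$, with both infinite series converging as formal power series in $u^{-1}$, we have $$\Delta(e(u))=1\otimes e(u)+\sum_{r=0}^{\infty}(-1)^r\Big(e(u)\otimes f(u+1)+e_{11'}(u)\otimes\big(f_{1'1}(u+1)-2f(u+1)^2\big)\Big)^r\Big(e(u)\otimes1+e_{11'}(u)\otimes\big(\tfrac13f(u-\tfrac12)+\tfrac23f(u+1)\big)\Big)\big(1\otimes k(u)\big)$$ and $$\Delta(f(u))=f(u)\otimes1+\big(k(u)\otimes1\big)\Big(1\otimes f(u)-\big(\tfrac13e(u-\tfrac12)+\tfrac23e(u+1)\big)\otimes f_{1'1}(u)\Big)\sum_{r=0}^{\infty}(-1)^r\Big(e(u+1)\otimes f(u)+\big(e_{11'}(u+1)+2e(u+1)^2\big)\otimes f_{1'1}(u)\Big)^r .$$ -/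

import Mathlib

open scoped PowerSeries TensorProduct DirectSum

noncomputable section

namespace OspYangian

/-! ### Superalgebras

A `ℤ/2`-grading of a complex algebra is recorded by its parity automorphism `σ`, which is `1` on the
even part and `-1` on the odd part. -/

section SuperGrading

/-- The homogeneous component of parity `i`: the `(-1)^i`-eigenspace of the parity automorphism. -/
def superPart {A : Type*} [Ring A] [Algebra ℂ A] (σ : A →ₐ[ℂ] A) (i : ZMod 2) : Submodule ℂ A where
  carrier := {a | σ a = (-1 : ℂ) ^ i.val • a}
  add_mem' := by
    intro a b ha hb
    simp only [Set.mem_ofPred_eq] at *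
    rw [map_add, ha, hb, smul_add]
  zero_mem' := by simp
  smul_mem' := by
    intro c a ha
    simp only [Set.mem_ofPred_eq] at *
    rw [map_smul, ha, smul_comm]

theorem mem_superPart {A : Type*} [Ring A] [Algebra ℂ A] {σ : A →ₐ[ℂ] A} {i : ZMod 2} {a : A} :
    a ∈ superPart σ i ↔ σ a = (-1 : ℂ) ^ i.val • a := Iff.rfl

theorem neg_one_pow_val_add (i j : ZMod 2) :
    (-1 : ℂ) ^ (i + j).val = (-1 : ℂ) ^ i.val * (-1 : ℂ) ^ j.val := by
  rw [ZMod.val_add, ← pow_add, neg_one_pow_eq_pow_mod_two (n := i.val + j.val)]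

theorem val_zero_two : (0 : ZMod 2).val = 0 := rfl

theorem val_one_two : (1 : ZMod 2).val = 1 := rfl

theorem add_eq_one_of_ne : ∀ i j : ZMod 2, j ≠ i → j + i = 1 := by decide

/-- The projection to the component of parity `i` along the other one. -/
def superProj {A : Type*} [Ring A] [Algebra ℂ A] (σ : A →ₐ[ℂ] A)
    (hσ : ∀ a, σ (σ a) = a) (i : ZMod 2) : A →ₗ[ℂ] superPart σ i :=
  LinearMap.codRestrict (superPart σ i)
    ((1 / 2 : ℂ) • (LinearMap.id + (-1 : ℂ) ^ i.val • σ.toLinearMap)) (by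
      intro a
      rw [mem_superPart]
      have h : (-1 : ℂ) ^ i.val * (-1 : ℂ) ^ i.val = 1 := by rw [← mul_pow]; simp
      simp only [LinearMap.smul_apply, LinearMap.add_apply, LinearMap.id_apply,
        AlgHom.toLinearMap_apply, map_smul, map_add, hσ, smul_add, smul_smul]
      rw [add_comm]
      congr 2
      · ring
      · rw [mul_left_comm, h, mul_one])

theorem coe_superProj {A : Type*} [Ring A] [Algebra ℂ A] (σ : A →ₐ[ℂ] A)
    (hσ : ∀ a, σ (σ a) = a) (i : ZMod 2) (a : A) :
    (superProj σ hσ i a : A) = (1 / 2 : ℂ) • (a + (-1 : ℂ) ^ i.val • σ a) := rfl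

/-- The homogeneous components of an involutive parity automorphism form a grading. -/
@[reducible]
def superGradedAlgebra {A : Type*} [Ring A] [Algebra ℂ A] (σ : A →ₐ[ℂ] A)
    (hσ : ∀ a, σ (σ a) = a) : GradedAlgebra (superPart σ) where
  one_mem := by simp [mem_superPart]
  mul_mem := by
    intro i j a b ha hb
    rw [mem_superPart] at *
    rw [map_mul, ha, hb, neg_one_pow_val_add, smul_mul_smul_comm]
  toDecomposition := DirectSum.Decomposition.ofLinearMap _
    (∑ i : ZMod 2, (DirectSum.lof ℂ (ZMod 2) (fun i => superPart σ i) i).comp (superProj σ hσ i))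
    (by
      ext a
      have h2 : (Finset.univ : Finset (ZMod 2)) = {0, 1} := rfl
      simp only [h2, LinearMap.comp_apply, LinearMap.sum_apply, map_sum,
        DirectSum.coeLinearMap_lof, coe_superProj, LinearMap.id_apply]
      rw [Finset.sum_pair (by decide), val_zero_two, val_one_two, ← smul_add]
      have : a + (-1 : ℂ) ^ 0 • σ a + (a + (-1 : ℂ) ^ 1 • σ a) = (2 : ℂ) • a := by
        rw [two_smul]; simp; abel
      rw [this, smul_smul]; norm_num)
    (by
      ext i x : 2
      have hx : σ (x : A) = (-1 : ℂ) ^ i.val • (x : A) := x.2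
      simp only [LinearMap.comp_apply, LinearMap.sum_apply, DirectSum.coeLinearMap_lof,
        LinearMap.id_apply]
      rw [Finset.sum_eq_single i]
      · congr 1
        apply Subtype.ext
        rw [coe_superProj, hx, smul_smul, ← mul_pow]
        simp only [neg_mul_neg, one_mul, one_pow, one_smul, ← two_smul ℂ (x : A), smul_smul]
        norm_num
      · intro j _ hj
        have : superProj σ hσ j (x : A) = 0 := by
          apply Subtype.ext
          rw [coe_superProj, hx, smul_smul]
          have h : (-1 : ℂ) ^ j.val * (-1 : ℂ) ^ i.val = -1 := by
            rw [← neg_one_pow_val_add]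
            have : j + i = 1 := add_eq_one_of_ne i j hj
            rw [this, val_one_two, pow_one]
          rw [h]; simp
        rw [this, map_zero]
      · simp)

end SuperGrading

/-! ### The RTT relation for `osp(1|2)`

The indices `1, 2, 1'` are written `0, 1, 2 : Fin 3`, so that `i'` is `Fin.rev i`. A formal series
`∑ aᵣ u^{-r}` is the power series `∑ aᵣ X^r`, that is, `X` is `u⁻¹`. -/

/-- The parity of the basis vector `e_i` of `ℂ^{1|2}` (an index is odd unless it is the middle one). -/
def par (i : Fin 3) : ℕ := if i = 1 then 0 else 1

/-- The signs `θ₁ = θ₂ = 1`, `θ_{1'} = -1`. -/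
def theta (i : Fin 3) : ℂ := if i = 2 then -1 else 1

/-- The parameter `κ = -m - 1/2` for `m = 1`. -/
def kappa : ℂ := -3 / 2

/-- `a : Tens A` stands for `∑ e_{ij} ⊗ e_{kl} ⊗ a i j k l` in `End ℂ^{1|2} ⊗ End ℂ^{1|2} ⊗ A`.
All elements used below are even, that is, `a i j k l` has the parity of `e_{ij} ⊗ e_{kl}`. -/
abbrev Tens (A : Type*) := Fin 3 → Fin 3 → Fin 3 → Fin 3 → A

/-- The product of even elements of the superalgebra `End ℂ^{1|2} ⊗ End ℂ^{1|2} ⊗ A`. The sign is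
the one produced by the rule `(x ⊗ y)(x' ⊗ y') = (-1)^{p(y)p(x')} xx' ⊗ yy'`: in
`(e_{im} ⊗ e_{kn} ⊗ a)(e_{mj} ⊗ e_{nl} ⊗ b)` the factor `e_{mj}` moves past `e_{kn} ⊗ a`, whose
parity is that of `e_{im}`, and `e_{nl}` moves past `a`, whose parity is that of
`e_{im} ⊗ e_{kn}`. -/
def tensMul {A : Type*} [Ring A] (a b : Tens A) : Tens A := fun i j k l =>
  ∑ m, ∑ n, (-1 : A) ^ ((par i + par m) * (par m + par j) +
    (par i + par m + par k + par n) * (par n + par l)) * (a i m k n * b m j n l)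

/-- The identity element `1 ⊗ 1 ⊗ 1`. -/
def tensOne {A : Type*} [Ring A] : Tens A := fun i j k l => if i = j ∧ k = l then 1 else 0

/-- `P = ∑ e_{ij} ⊗ e_{ji} (-1)^{p(j)}`. -/
def tensP {A : Type*} [Ring A] : Tens A := fun i j k l =>
  if k = j ∧ l = i then (-1) ^ par j else 0

/-- `Q = ∑ e_{ij} ⊗ e_{i'j'} (-1)^{p(i)p(j)} θ_i θ_j`. -/
def tensQ {A : Type*} [Ring A] [Algebra ℂ A] : Tens A := fun i j k l =>
  if k = i.rev ∧ l = j.rev then algebraMap ℂ A ((-1) ^ (par i * par j) * theta i * theta j) else 0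

/-- The element `a_1 = ∑ e_{ij} ⊗ 1 ⊗ a_{ij} (-1)^{p(i)p(j)+p(j)}` for an even matrix `a`. -/
def tensFst {A : Type*} [Ring A] (a : Fin 3 → Fin 3 → A) : Tens A := fun i j k l =>
  if k = l then (-1) ^ (par i * par j + par j) * a i j else 0

/-- The element `a_2 = ∑ 1 ⊗ e_{ij} ⊗ a_{ij} (-1)^{p(i)p(j)+p(j)}` for an even matrix `a`. -/
def tensSnd {A : Type*} [Ring A] (a : Fin 3 → Fin 3 → A) : Tens A := fun i j k l =>
  if i = j then (-1) ^ (par k * par l + par l) * a k l else 0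

section TwoVariables

variable (A : Type*) [Ring A]

/-- `u⁻¹`, in the ring `A⟦X⟧⟦X⟧` of formal series in `u⁻¹` (outer variable) and `v⁻¹` (inner). -/
def uInv : A⟦X⟧⟦X⟧ := PowerSeries.X

/-- `v⁻¹`. -/
def vInv : A⟦X⟧⟦X⟧ := PowerSeries.C PowerSeries.X

variable {A}

/-- The series `a(u)`. -/
def atU : A⟦X⟧ →+* A⟦X⟧⟦X⟧ := PowerSeries.map PowerSeries.C

/-- The series `a(v)`. -/
def atV : A⟦X⟧ →+* A⟦X⟧⟦X⟧ := PowerSeries.C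

end TwoVariables

/-- The `R`-matrix `R(u - v) = 1 - P / (u - v) + Q / (u - v - κ)` with its denominators cleared:
this is `u⁻² v⁻² (u - v) (u - v - κ) R(u - v)`, written through
`u⁻¹ v⁻¹ (u - v) = v⁻¹ - u⁻¹` and `u⁻¹ v⁻¹ (u - v - κ) = v⁻¹ - u⁻¹ - κ u⁻¹ v⁻¹`. -/
def rMatrix (A : Type*) [Ring A] [Algebra ℂ A] : Tens (A⟦X⟧⟦X⟧) := fun i j k l =>
  (vInv A - uInv A) * (vInv A - uInv A - kappa • (uInv A * vInv A)) * tensOne i j k l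
  - uInv A * vInv A * (vInv A - uInv A - kappa • (uInv A * vInv A)) * tensP i j k l
  + uInv A * vInv A * (vInv A - uInv A) * tensQ i j k l

/-- The difference `R(u - v) T₁(u) T₂(v) - T₂(v) T₁(u) R(u - v)`, with denominators cleared. -/
def rttDefect {A : Type*} [Ring A] [Algebra ℂ A] (T : Fin 3 → Fin 3 → A⟦X⟧) : Tens (A⟦X⟧⟦X⟧) :=
  tensMul (tensMul (rMatrix A) (tensFst fun i j => atU (T i j))) (tensSnd fun i j => atV (T i j))
  - tensMul (tensMul (tensSnd fun i j => atV (T i j)) (tensFst fun i j => atU (T i j))) (rMatrix A)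

/-- The index `(i, j, r)` labels the generator `t_{ij}^{(r+1)}`. -/
abbrev Gen := Fin 3 × Fin 3 × ℕ

/-- The matrix `δ_{ij} + ∑_{r ≥ 1} a_{ij}^{(r)} u^{-r}` built from a family of coefficients. -/
def genSeries {A : Type*} [Ring A] (a : Gen → A) (i j : Fin 3) : A⟦X⟧ := PowerSeries.mk fun r =>
  match r with
  | 0 => if i = j then 1 else 0
  | r + 1 => a (i, j, r)

/-- The defining relations of the extended Yangian: all coefficients of the `RTT`-relation. -/
inductive RTTRel : FreeAlgebra ℂ Gen → FreeAlgebra ℂ Gen → Prop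
  | rtt (i j k l : Fin 3) (m n : ℕ) :
      RTTRel (PowerSeries.coeff n (PowerSeries.coeff m
        (rttDefect (genSeries (FreeAlgebra.ι ℂ)) i j k l))) 0

/-- The extended Yangian `X(osp(1|2))`. -/
def ExtYangian : Type := RingQuot RTTRel

instance : Ring ExtYangian := inferInstanceAs (Ring (RingQuot RTTRel))

instance : Algebra ℂ ExtYangian := inferInstanceAs (Algebra ℂ (RingQuot RTTRel))

/-- The generator `t_{ij}^{(r+1)}` of the extended Yangian. -/
def gen (x : Gen) : ExtYangian := RingQuot.mkAlgHom ℂ RTTRel (FreeAlgebra.ι ℂ x)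

/-- The series `t_{ij}(u)`. -/
def tSeries (i j : Fin 3) : ExtYangian⟦X⟧ := genSeries gen i j

/-! #### Functoriality and the universal property -/

theorem genSeries_coeff {A : Type*} [Ring A] (T : Fin 3 → Fin 3 → A⟦X⟧)
    (hT : ∀ i j, PowerSeries.constantCoeff (T i j) = if i = j then 1 else 0) :
    genSeries (fun x : Gen => PowerSeries.coeff (x.2.2 + 1) (T x.1 x.2.1)) = T := by
  funext i j
  ext r
  cases r with
  | zero => simp [genSeries, hT]
  | succ r => simp [genSeries]

section Map

variable {A B : Type*} [Ring A] [Ring B] [Algebra ℂ A] [Algebra ℂ B]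

theorem map_genSeries (f : A →ₐ[ℂ] B) (a : Gen → A) (i j : Fin 3) :
    PowerSeries.map (f : A →+* B) (genSeries a i j) = genSeries (fun x => f (a x)) i j := by
  ext r
  cases r with
  | zero => simp only [genSeries, PowerSeries.coeff_map, PowerSeries.coeff_mk]; split_ifs <;> simp
  | succ r => simp [genSeries]

/-- The map induced on series in two variables. -/
def map₂ (f : A →ₐ[ℂ] B) : A⟦X⟧⟦X⟧ →+* B⟦X⟧⟦X⟧ :=
  PowerSeries.map (PowerSeries.map (f : A →+* B))

theorem map₂_uInv (f : A →ₐ[ℂ] B) : map₂ f (uInv A) = uInv B := by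
  simp [map₂, uInv]

theorem map₂_vInv (f : A →ₐ[ℂ] B) : map₂ f (vInv A) = vInv B := by
  simp [map₂, vInv]

theorem map₂_atU (f : A →ₐ[ℂ] B) (a : A⟦X⟧) :
    map₂ f (atU a) = atU (PowerSeries.map (f : A →+* B) a) := by
  ext m n
  simp only [map₂, atU, PowerSeries.coeff_map, PowerSeries.map_C]

theorem map₂_atV (f : A →ₐ[ℂ] B) (a : A⟦X⟧) :
    map₂ f (atV a) = atV (PowerSeries.map (f : A →+* B) a) := by
  simp [map₂, atV]

theorem map₂_smul (f : A →ₐ[ℂ] B) (c : ℂ) (a : A⟦X⟧⟦X⟧) : map₂ f (c • a) = c • map₂ f a := by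
  ext m n
  simp [map₂]

theorem map₂_algebraMap (f : A →ₐ[ℂ] B) (c : ℂ) :
    map₂ f (algebraMap ℂ (A⟦X⟧⟦X⟧) c) = algebraMap ℂ (B⟦X⟧⟦X⟧) c := by
  rw [Algebra.algebraMap_eq_smul_one, Algebra.algebraMap_eq_smul_one, map₂_smul, map_one]

theorem map_tensMul {A B : Type*} [Ring A] [Ring B] (f : A →+* B) (a b : Tens A) (i j k l : Fin 3) :
    f (tensMul a b i j k l) =
      tensMul (fun i j k l => f (a i j k l)) (fun i j k l => f (b i j k l)) i j k l := by
  simp [tensMul]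

theorem map₂_rMatrix (f : A →ₐ[ℂ] B) (i j k l : Fin 3) :
    map₂ f (rMatrix A i j k l) = rMatrix B i j k l := by
  simp only [rMatrix, map_add, map_sub, map_mul, map₂_smul, map₂_uInv, map₂_vInv, tensOne, tensP,
    tensQ, apply_ite (map₂ f), map_one, map_zero, map_pow, map_neg, map₂_algebraMap]

theorem map₂_rttDefect (f : A →ₐ[ℂ] B) (T : Fin 3 → Fin 3 → A⟦X⟧) (i j k l : Fin 3) :
    map₂ f (rttDefect T i j k l) =
      rttDefect (fun i j => PowerSeries.map (f : A →+* B) (T i j)) i j k l := by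
  simp only [rttDefect, Pi.sub_apply, map_sub, map_tensMul, map₂_rMatrix, tensFst, tensSnd,
    apply_ite (map₂ f), map_zero, map_mul, map_pow, map_neg, map_one, map₂_atU, map₂_atV]
  rfl

end Map

theorem rttDefect_tSeries : rttDefect tSeries = 0 := by
  funext i j k l
  have h := map₂_rttDefect (RingQuot.mkAlgHom ℂ RTTRel) (genSeries (FreeAlgebra.ι ℂ)) i j k l
  simp only [map_genSeries] at h
  have h' : rttDefect tSeries i j k l = map₂ (RingQuot.mkAlgHom ℂ RTTRel)
      (rttDefect (genSeries (FreeAlgebra.ι ℂ)) i j k l) := h.symm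
  rw [h']
  ext m n
  have := RingQuot.mkAlgHom_rel ℂ (RTTRel.rtt i j k l m n)
  rw [map_zero] at this
  exact this

/-- The universal property of the extended Yangian: a matrix of series satisfying the
`RTT`-relation gives a homomorphism. -/
def liftX {B : Type*} [Ring B] [Algebra ℂ B] (T : Fin 3 → Fin 3 → B⟦X⟧)
    (h0 : ∀ i j, PowerSeries.constantCoeff (T i j) = if i = j then 1 else 0)
    (h : rttDefect T = 0) : ExtYangian →ₐ[ℂ] B :=
  RingQuot.liftAlgHom ℂ ⟨FreeAlgebra.lift ℂ fun x => PowerSeries.coeff (x.2.2 + 1) (T x.1 x.2.1), by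
    intro a b hab
    obtain ⟨i, j, k, l, m, n⟩ := hab
    have h1 := map₂_rttDefect (FreeAlgebra.lift ℂ fun x : Gen =>
      PowerSeries.coeff (x.2.2 + 1) (T x.1 x.2.1)) (genSeries (FreeAlgebra.ι ℂ)) i j k l
    simp only [map_genSeries, FreeAlgebra.lift_ι_apply, genSeries_coeff T h0] at h1
    have h2 := congrArg (fun s => PowerSeries.coeff n (PowerSeries.coeff m s)) h1
    rw [map_zero]
    refine Eq.trans h2 ?_
    simp [h]⟩

theorem map_liftX {B : Type*} [Ring B] [Algebra ℂ B] (T : Fin 3 → Fin 3 → B⟦X⟧)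
    (h0 : ∀ i j, PowerSeries.constantCoeff (T i j) = if i = j then 1 else 0)
    (h : rttDefect T = 0) (i j : Fin 3) :
    PowerSeries.map (liftX T h0 h : ExtYangian →+* B) (tSeries i j) = T i j := by
  rw [tSeries, map_genSeries]
  have : (fun x => liftX T h0 h (gen x)) =
      fun x : Gen => PowerSeries.coeff (x.2.2 + 1) (T x.1 x.2.1) := by
    funext x
    erw [RingQuot.liftAlgHom_mkAlgHom_apply]
    simp
  rw [this, genSeries_coeff T h0]

theorem extYangian_hom_ext {B : Type*} [Ring B] [Algebra ℂ B] {f g : ExtYangian →ₐ[ℂ] B}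
    (h : ∀ i j, PowerSeries.map (f : ExtYangian →+* B) (tSeries i j) =
      PowerSeries.map (g : ExtYangian →+* B) (tSeries i j)) : f = g := by
  refine RingQuot.ringQuot_ext' (s := RTTRel) ℂ f g ?_
  apply FreeAlgebra.hom_ext
  funext x
  have := congrArg (PowerSeries.coeff (x.2.2 + 1)) (h x.1 x.2.1)
  simp only [tSeries, genSeries, PowerSeries.coeff_map, PowerSeries.coeff_mk] at this
  exact this

theorem constantCoeff_tSeries (i j : Fin 3) :
    PowerSeries.constantCoeff (tSeries i j) = if i = j then 1 else 0 := by
  simp [tSeries, genSeries, ← PowerSeries.coeff_zero_eq_constantCoeff_apply]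

/-! #### Algebraic properties of the signed product -/

section TensMul

variable {A : Type*} [Ring A]

theorem par_sq (R : Type) [CommRing R] (i : Fin 3) : (par i : R) ^ 2 = par i := by
  unfold par; split_ifs <;> simp

theorem neg_one_pow_congr' {m n : ℕ}
    (h : ∀ (R : Type) [CommRing R], (2 : R) = 0 → (m : R) = n) : (-1 : A) ^ m = (-1) ^ n := by
  replace h := h (ZMod 2) rfl
  rw [neg_one_pow_eq_pow_mod_two (n := m), neg_one_pow_eq_pow_mod_two (n := n)]
  rw [(ZMod.natCast_eq_natCast_iff' m n 2).mp h]

theorem sign_mul_mul (m n : ℕ) (a b : A) :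
    (-1 : A) ^ m * (a * ((-1) ^ n * b)) = (-1) ^ (m + n) * (a * b) := by
  rw [pow_add, mul_assoc, ← mul_assoc a, ← ((Commute.neg_one_left a).pow_left n).eq, mul_assoc]

theorem sign_mul_mul' (m n : ℕ) (a b : A) :
    (-1 : A) ^ m * (((-1) ^ n * a) * b) = (-1) ^ (m + n) * (a * b) := by
  rw [pow_add, mul_assoc, mul_assoc]

theorem tensMul_assoc (a b c : Tens A) : tensMul (tensMul a b) c = tensMul a (tensMul b c) := by
  funext i j k l
  have e1 : ∀ i m n k j l m' n', (-1 : A) ^ ((par i + par m') * (par m' + par j) +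
      (par i + par m' + par k + par n') * (par n' + par l)) *
      ((-1) ^ ((par i + par m) * (par m + par m') + (par i + par m + par k + par n) *
      (par n + par n')) * (a i m k n * b m m' n n') * c m' j n' l) =
      (-1 : A) ^ ((par i + par m) * (par m + par j) +
      (par i + par m + par k + par n) * (par n + par l)) *
      (a i m k n * ((-1) ^ ((par m + par m') * (par m' + par j) +
      (par m + par m' + par n + par n') * (par n' + par l)) * (b m m' n n' * c m' j n' l))) := by
    intro i m n k j l m' n'
    rw [sign_mul_mul, sign_mul_mul', mul_assoc (a i m k n)]
    congr 1
    apply neg_one_pow_congr'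
    intro R _ h2
    push_cast
    grind
  simp only [tensMul, Finset.mul_sum, Finset.sum_mul]
  have hL : ∀ f : Fin 3 → Fin 3 → Fin 3 → Fin 3 → A,
      ∑ m', ∑ n', ∑ m, ∑ n, f m' n' m n = ∑ m, ∑ n, ∑ m', ∑ n', f m' n' m n := by
    intro f
    rw [Finset.sum_congr rfl fun m' _ => Finset.sum_comm, Finset.sum_comm]
    refine Finset.sum_congr rfl fun m _ => ?_
    rw [Finset.sum_congr rfl fun m' _ => Finset.sum_comm, Finset.sum_comm]
  rw [hL]
  refine Finset.sum_congr rfl fun m _ => Finset.sum_congr rfl fun n _ =>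
    Finset.sum_congr rfl fun m' _ => Finset.sum_congr rfl fun n' _ => e1 _ _ _ _ _ _ _ _

theorem tensMul_smul_left (z : A) (a b : Tens A) :
    tensMul (fun i j k l => z * a i j k l) b = fun i j k l => z * tensMul a b i j k l := by
  funext i j k l
  simp only [tensMul, Finset.mul_sum]
  refine Finset.sum_congr rfl fun m _ => Finset.sum_congr rfl fun n _ => ?_
  rw [← mul_assoc z, ← ((Commute.neg_one_left z).pow_left _).eq]
  simp only [mul_assoc]

theorem tensMul_smul_right (z : A) (hz : ∀ x, z * x = x * z) (a b : Tens A) :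
    tensMul a (fun i j k l => z * b i j k l) = fun i j k l => z * tensMul a b i j k l := by
  funext i j k l
  simp only [tensMul, Finset.mul_sum]
  refine Finset.sum_congr rfl fun m _ => Finset.sum_congr rfl fun n _ => ?_
  rw [hz, ← mul_assoc (a i m k n), ← mul_assoc, ← hz]

/-- The parity automorphism on families of coefficients. -/
def tensSign (a : Tens A) : Tens A := fun i j k l =>
  (-1) ^ (par i + par j + par k + par l) * a i j k l

theorem tensMul_sign (a b : Tens A) :
    tensMul (tensSign a) (tensSign b) = tensSign (tensMul a b) := by
  funext i j k l
  simp only [tensMul, tensSign, Finset.mul_sum]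
  refine Finset.sum_congr rfl fun m _ => Finset.sum_congr rfl fun n _ => ?_
  rw [mul_assoc ((-1) ^ _) (a i m k n), sign_mul_mul, ← mul_assoc, ← pow_add,
    ← mul_assoc ((-1) ^ (par i + par j + par k + par l)), ← pow_add]
  congr 1
  apply neg_one_pow_congr'
  intro R _ h2
  push_cast
  grind

theorem tensMul_fst_snd (a b : Fin 3 → Fin 3 → A)
    (h : ∀ i j k l, a i j * b k l = (-1) ^ ((par i + par j) * (par k + par l)) * (b k l * a i j)) :
    tensMul (tensFst a) (tensSnd b) = tensMul (tensSnd b) (tensFst a) := by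
  funext i j k l
  have h1 : tensMul (tensFst a) (tensSnd b) i j k l =
      (-1) ^ ((par i + par j) * (par k + par l)) * (((-1) ^ (par i * par j + par j) * a i j) *
        ((-1) ^ (par k * par l + par l) * b k l)) := by
    simp only [tensMul, tensFst, tensSnd]
    rw [Finset.sum_eq_single j, Finset.sum_eq_single k]
    · simp only [if_true]
      congr 1
      apply neg_one_pow_congr'
      intro R _ h2
      push_cast
      grind
    · intro n _ hn; simp [hn.symm]
    · simp
    · intro m _ hm; simp [hm]
    · simp
  have h2 : tensMul (tensSnd b) (tensFst a) i j k l =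
      ((-1) ^ (par k * par l + par l) * b k l) * ((-1) ^ (par i * par j + par j) * a i j) := by
    simp only [tensMul, tensFst, tensSnd]
    rw [Finset.sum_eq_single i, Finset.sum_eq_single l]
    · simp only [if_true]
      rw [neg_one_pow_congr' (n := 0), pow_zero, one_mul]
      intro R _ h2
      push_cast
      grind
    · intro n _ hn; simp [hn]
    · simp
    · intro m _ hm; simp [hm.symm]
    · simp
  rw [h1, h2]
  rw [mul_assoc, sign_mul_mul, ← mul_assoc, ← pow_add, mul_assoc ((-1) ^ _) (b k l),
    ← one_mul ((-1) ^ (par k * par l + par l) * _), ← pow_zero (-1 : A), pow_zero, one_mul,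
    ← mul_assoc (b k l), ← ((Commute.neg_one_left (b k l)).pow_left _).eq, mul_assoc,
    ← mul_assoc ((-1) ^ _) ((-1) ^ _), ← pow_add, h, ← mul_assoc, ← pow_add]
  congr 1
  apply neg_one_pow_congr'
  intro R _ h2
  push_cast
  grind

theorem tensMul_fst_fst (a b : Fin 3 → Fin 3 → A) :
    tensMul (tensFst a) (tensFst b) = tensFst (fun i j => ∑ k, a i k * b k j) := by
  funext i j k l
  simp only [tensMul, tensFst]
  by_cases hkl : k = l
  · subst hkl
    simp only [if_true, Finset.mul_sum]
    refine Finset.sum_congr rfl fun m _ => ?_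
    rw [Finset.sum_eq_single k]
    · simp only [if_true]
      rw [mul_assoc ((-1) ^ _) (a i m), sign_mul_mul, ← mul_assoc, ← pow_add]
      congr 1
      apply neg_one_pow_congr'
      intro R _ h2
      have h3 := par_sq R m
      push_cast
      grind
    · intro n _ hn; simp [hn]
    · simp
  · rw [if_neg hkl]
    refine Finset.sum_eq_zero fun m _ => Finset.sum_eq_zero fun n _ => ?_
    by_cases h : k = n
    · subst h; simp [hkl]
    · simp [h]

theorem tensMul_snd_snd (a b : Fin 3 → Fin 3 → A) :
    tensMul (tensSnd a) (tensSnd b) = tensSnd (fun i j => ∑ k, a i k * b k j) := by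
  funext i j k l
  simp only [tensMul, tensSnd]
  by_cases hij : i = j
  · subst hij
    simp only [if_true, Finset.mul_sum]
    rw [Finset.sum_eq_single i]
    · refine Finset.sum_congr rfl fun n _ => ?_
      simp only [if_true]
      rw [mul_assoc ((-1) ^ _) (a k n), sign_mul_mul, ← mul_assoc, ← pow_add]
      congr 1
      apply neg_one_pow_congr'
      intro R _ h2
      have h3 := par_sq R n
      push_cast
      grind
    · intro n _ hn; simp [hn.symm]
    · simp
  · rw [if_neg hij]
    refine Finset.sum_eq_zero fun m _ => Finset.sum_eq_zero fun n _ => ?_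
    by_cases h : i = m
    · subst h; simp [hij]
    · simp [h]

end TensMul

/-! #### Solutions of the RTT relation -/

section Solutions

variable {A : Type*} [Ring A]

theorem coeff_atU_mul_atV (a b : A⟦X⟧) (m n : ℕ) :
    PowerSeries.coeff n (PowerSeries.coeff m (atU a * atV b)) =
      PowerSeries.coeff m a * PowerSeries.coeff n b := by
  simp [atU, atV, PowerSeries.coeff_mul_C, PowerSeries.coeff_C_mul]

theorem coeff_atV_mul_atU (a b : A⟦X⟧) (m n : ℕ) :
    PowerSeries.coeff n (PowerSeries.coeff m (atV b * atU a)) =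
      PowerSeries.coeff n b * PowerSeries.coeff m a := by
  simp [atU, atV, PowerSeries.coeff_mul_C, PowerSeries.coeff_C_mul]

theorem coeff_sign_mul (p m n : ℕ) (x : A⟦X⟧⟦X⟧) :
    PowerSeries.coeff n (PowerSeries.coeff m ((-1) ^ p * x)) =
      (-1) ^ p * PowerSeries.coeff n (PowerSeries.coeff m x) := by
  rcases neg_one_pow_eq_or (A⟦X⟧⟦X⟧) p with h | h
  · rcases Nat.even_or_odd p with h' | h'
    · simp [h'.neg_one_pow]
    · simp [h'.neg_one_pow]
  · rcases Nat.even_or_odd p with h' | h'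
    · simp [h'.neg_one_pow]
    · simp [h'.neg_one_pow]

variable [Algebra ℂ A]

theorem rttDefect_eq_zero_iff (T : Fin 3 → Fin 3 → A⟦X⟧) : rttDefect T = 0 ↔
    tensMul (tensMul (rMatrix A) (tensFst fun i j => atU (T i j))) (tensSnd fun i j => atV (T i j))
    = tensMul (tensMul (tensSnd fun i j => atV (T i j)) (tensFst fun i j => atU (T i j)))
      (rMatrix A) := sub_eq_zero

theorem reorder {M : Type*} [Semigroup M] {R S₁ S₂ T₁ T₂ : M} (hS : R * S₁ * S₂ = S₂ * S₁ * R)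
    (hT : R * T₁ * T₂ = T₂ * T₁ * R) (h₁ : T₁ * S₂ = S₂ * T₁) (h₂ : S₁ * T₂ = T₂ * S₁) :
    R * (S₁ * T₁) * (S₂ * T₂) = S₂ * T₂ * (S₁ * T₁) * R := by
  calc R * (S₁ * T₁) * (S₂ * T₂) = R * S₁ * (T₁ * S₂) * T₂ := by simp only [mul_assoc]
    _ = R * S₁ * S₂ * (T₁ * T₂) := by rw [h₁]; simp only [mul_assoc]
    _ = S₂ * S₁ * (R * T₁ * T₂) := by rw [hS]; simp only [mul_assoc]
    _ = S₂ * (S₁ * T₂) * T₁ * R := by rw [hT]; simp only [mul_assoc]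
    _ = S₂ * T₂ * (S₁ * T₁) * R := by rw [h₂]; simp only [mul_assoc]

/-- The product of two mutually supercommuting solutions of the `RTT`-relation is a solution. -/
theorem rttDefect_mul (S T : Fin 3 → Fin 3 → A⟦X⟧) (hS : rttDefect S = 0) (hT : rttDefect T = 0)
    (h : ∀ i j k l m n, PowerSeries.coeff m (T i j) * PowerSeries.coeff n (S k l) =
      (-1) ^ ((par i + par j) * (par k + par l)) *
        (PowerSeries.coeff n (S k l) * PowerSeries.coeff m (T i j))) :
    rttDefect (fun i j => ∑ k, S i k * T k j) = 0 := by
  rw [rttDefect_eq_zero_iff] at *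
  simp only [map_sum, map_mul, ← tensMul_fst_fst, ← tensMul_snd_snd]
  let _ : Semigroup (Tens (A⟦X⟧⟦X⟧)) := { mul := tensMul, mul_assoc := tensMul_assoc }
  refine reorder (M := Tens (A⟦X⟧⟦X⟧)) hS hT ?_ ?_
  · refine tensMul_fst_snd _ _ fun i j k l => ?_
    ext m n
    rw [coeff_sign_mul, coeff_atU_mul_atV, coeff_atV_mul_atU, h]
  · refine tensMul_fst_snd _ _ fun i j k l => ?_
    ext m n
    rw [coeff_sign_mul, coeff_atU_mul_atV, coeff_atV_mul_atU, h, ← mul_assoc, ← pow_add,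
      neg_one_pow_congr' (n := 0), pow_zero, one_mul]
    intro R _ h2
    push_cast
    grind

theorem tensSign_rMatrix : tensSign (rMatrix A) = rMatrix A := by
  funext i j k l
  rcases Nat.even_or_odd (par i + par j + par k + par l) with h | h
  · simp [tensSign, h.neg_one_pow]
  · have : rMatrix A i j k l = 0 := by
      have h1 : ¬ (i = j ∧ k = l) := by
        rintro ⟨rfl, rfl⟩
        rw [← Nat.not_even_iff_odd] at h
        exact h ⟨par i + par k, by ring⟩
      have h2 : ¬ (k = j ∧ l = i) := by
        rintro ⟨rfl, rfl⟩
        rw [← Nat.not_even_iff_odd] at h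
        exact h ⟨par k + par l, by ring⟩
      have h3 : ¬ (k = i.rev ∧ l = j.rev) := by
        rintro ⟨rfl, rfl⟩
        rw [← Nat.not_even_iff_odd] at h
        have h4 : ∀ i, par (Fin.rev i) = par i := by decide
        rw [h4, h4] at h
        exact h ⟨par i + par j, by ring⟩
      simp [rMatrix, tensOne, tensP, tensQ, h1, h2, h3]
    simp [tensSign, this]

/-- The matrix `(-1)^{p(i)+p(j)} T_{ij}`. -/
def signMatrix (T : Fin 3 → Fin 3 → A⟦X⟧) (i j : Fin 3) : A⟦X⟧ := (-1) ^ (par i + par j) * T i j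

theorem rttDefect_sign (T : Fin 3 → Fin 3 → A⟦X⟧) (hT : rttDefect T = 0) :
    rttDefect (signMatrix T) = 0 := by
  rw [rttDefect_eq_zero_iff] at *
  have h1 : (tensFst fun i j => atU (signMatrix T i j)) =
      tensSign (tensFst fun i j => atU (T i j)) := by
    funext i j k l
    simp only [tensFst, tensSign, signMatrix, map_mul, map_pow, map_neg, map_one]
    split_ifs with hkl
    · subst hkl
      rw [← mul_assoc, ← mul_assoc, ← pow_add, ← pow_add]
      congr 1
      apply neg_one_pow_congr'
      intro R _ h2
      push_cast
      grind
    · simp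
  have h2 : (tensSnd fun i j => atV (signMatrix T i j)) =
      tensSign (tensSnd fun i j => atV (T i j)) := by
    funext i j k l
    simp only [tensSnd, tensSign, signMatrix, map_mul, map_pow, map_neg, map_one]
    split_ifs with hkl
    · subst hkl
      rw [← mul_assoc, ← mul_assoc, ← pow_add, ← pow_add]
      congr 1
      apply neg_one_pow_congr'
      intro R _ h2
      push_cast
      grind
    · simp
  rw [h1, h2]
  conv_lhs => rw [← tensSign_rMatrix]
  conv_rhs => rw [← tensSign_rMatrix]
  simp only [tensMul_sign, hT]

/-- A scalar series, viewed as a series with coefficients in `A`. -/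
def scalarSeries (A : Type*) [Ring A] [Algebra ℂ A] : ℂ⟦X⟧ →+* A⟦X⟧ :=
  PowerSeries.map (algebraMap ℂ A)

theorem scalarSeries_comm (φ : ℂ⟦X⟧) (a : A⟦X⟧) :
    scalarSeries A φ * a = a * scalarSeries A φ := by
  ext n
  rw [PowerSeries.coeff_mul, PowerSeries.coeff_mul, ← Finset.Nat.sum_antidiagonal_swap]
  refine Finset.sum_congr rfl fun p _ => ?_
  simp [scalarSeries, Algebra.commutes]

theorem atU_scalar_comm (φ : ℂ⟦X⟧) (x : A⟦X⟧⟦X⟧) :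
    atU (scalarSeries A φ) * x = x * atU (scalarSeries A φ) := by
  ext1 n
  rw [PowerSeries.coeff_mul, PowerSeries.coeff_mul, ← Finset.Nat.sum_antidiagonal_swap]
  refine Finset.sum_congr rfl fun p _ => ?_
  have : ∀ c : ℂ, PowerSeries.C (algebraMap ℂ A c) = scalarSeries A (PowerSeries.C c) := by
    intro c; simp [scalarSeries]
  simp only [atU, PowerSeries.coeff_map, Prod.fst_swap, Prod.snd_swap]
  simp only [scalarSeries, PowerSeries.coeff_map]
  rw [this, scalarSeries_comm]

theorem atV_scalar_comm (φ : ℂ⟦X⟧) (x : A⟦X⟧⟦X⟧) :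
    atV (scalarSeries A φ) * x = x * atV (scalarSeries A φ) := by
  ext1 n
  rw [atV, PowerSeries.coeff_C_mul, PowerSeries.coeff_mul_C, scalarSeries_comm]

theorem rttDefect_scalar (φ : ℂ⟦X⟧) (T : Fin 3 → Fin 3 → A⟦X⟧) (hT : rttDefect T = 0) :
    rttDefect (fun i j => scalarSeries A φ * T i j) = 0 := by
  rw [rttDefect_eq_zero_iff] at *
  have h1 : (tensFst fun i j => atU (scalarSeries A φ * T i j)) =
      fun i j k l => atU (scalarSeries A φ) * tensFst (fun i j => atU (T i j)) i j k l := by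
    funext i j k l
    simp only [tensFst, map_mul]
    split_ifs with hkl
    · rw [← mul_assoc, ← atU_scalar_comm, mul_assoc]
    · simp
  have h2 : (tensSnd fun i j => atV (scalarSeries A φ * T i j)) =
      fun i j k l => atV (scalarSeries A φ) * tensSnd (fun i j => atV (T i j)) i j k l := by
    funext i j k l
    simp only [tensSnd, map_mul]
    split_ifs with hkl
    · rw [← mul_assoc, ← atV_scalar_comm, mul_assoc]
    · simp
  rw [h1, h2]
  simp only [tensMul_smul_left,
    tensMul_smul_right (atU (scalarSeries A φ)) (atU_scalar_comm φ),
    tensMul_smul_right (atV (scalarSeries A φ)) (atV_scalar_comm φ), hT]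
  funext i j k l
  rw [← mul_assoc, ← mul_assoc, atU_scalar_comm]

end Solutions

/-! ### The superalgebra structure and the coproduct of the extended Yangian -/

/-- The parity automorphism of the extended Yangian: `t_{ij}^{(r)}` has parity `p(i) + p(j)`. -/
def parityX : ExtYangian →ₐ[ℂ] ExtYangian :=
  liftX (signMatrix tSeries) (by
    intro i j
    rw [signMatrix, map_mul, constantCoeff_tSeries]
    split_ifs with h
    · subst h
      simp [(Even.add_self (par i)).neg_one_pow]
    · simp) (rttDefect_sign _ rttDefect_tSeries)

theorem map_parityX (i j : Fin 3) :
    PowerSeries.map (parityX : ExtYangian →+* ExtYangian) (tSeries i j) =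
      (-1) ^ (par i + par j) * tSeries i j := map_liftX _ _ _ i j

theorem map_algHom_comp {A B C : Type*} [Ring A] [Ring B] [Ring C] [Algebra ℂ A] [Algebra ℂ B]
    [Algebra ℂ C] (g : B →ₐ[ℂ] C) (f : A →ₐ[ℂ] B) (a : A⟦X⟧) :
    PowerSeries.map (g.comp f : A →+* C) a =
      PowerSeries.map (g : B →+* C) (PowerSeries.map (f : A →+* B) a) := by
  ext n; simp

theorem map_algHom_id {A : Type*} [Ring A] [Algebra ℂ A] (a : A⟦X⟧) :
    PowerSeries.map (AlgHom.id ℂ A : A →+* A) a = a := by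
  ext n; simp

theorem parityX_parityX (x : ExtYangian) : parityX (parityX x) = x := by
  have : parityX.comp parityX = AlgHom.id ℂ ExtYangian := by
    apply extYangian_hom_ext
    intro i j
    rw [map_algHom_comp, map_algHom_id, map_parityX, map_mul, map_parityX, map_pow, map_neg,
      map_one, ← mul_assoc, ← pow_add, (Even.add_self _).neg_one_pow, one_mul]
  exact DFunLike.congr_fun this x

instance : GradedAlgebra (superPart parityX) := superGradedAlgebra parityX parityX_parityX

theorem coeff_tSeries_mem (i j : Fin 3) (n : ℕ) :
    PowerSeries.coeff n (tSeries i j) ∈ superPart parityX ((par i + par j : ℕ) : ZMod 2) := by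
  rw [mem_superPart, ZMod.val_natCast, ← neg_one_pow_eq_pow_mod_two]
  have h := congrArg (PowerSeries.coeff n) (map_parityX i j)
  rw [PowerSeries.coeff_map] at h
  refine h.trans ?_
  rcases Nat.even_or_odd (par i + par j) with h' | h'
  · simp [h'.neg_one_pow]
  · simp [h'.neg_one_pow]

/-- The tensor product `X(osp(1|2)) ⊗ X(osp(1|2))` of superalgebras, with the multiplication
`(a ⊗ b)(a' ⊗ b') = (-1)^{p(b)p(a')} aa' ⊗ bb'`. -/
abbrev ExtYangianSq : Type :=
  GradedTensorProduct ℂ (superPart parityX) (superPart parityX)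

/-- The element `a(u) ⊗ b(u) = ∑ (a_r ⊗ b_s) u^{-r-s}` for two series in `u⁻¹`. -/
def seriesTmul {A B : Type*} [Ring A] [Ring B] [Algebra ℂ A] [Algebra ℂ B]
    (𝒜 : ZMod 2 → Submodule ℂ A) (ℬ : ZMod 2 → Submodule ℂ B) [GradedAlgebra 𝒜] [GradedAlgebra ℬ]
    (a : A⟦X⟧) (b : B⟦X⟧) : (GradedTensorProduct ℂ 𝒜 ℬ)⟦X⟧ :=
  PowerSeries.mk fun n => ∑ p ∈ Finset.HasAntidiagonal.antidiagonal n,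
    GradedTensorProduct.tmul ℂ (PowerSeries.coeff p.1 a) (PowerSeries.coeff p.2 b)

section Graded

variable {A B : Type*} [Ring A] [Ring B] [Algebra ℂ A] [Algebra ℂ B]
  (𝒜 : ZMod 2 → Submodule ℂ A) (ℬ : ZMod 2 → Submodule ℂ B) [GradedAlgebra 𝒜] [GradedAlgebra ℬ]

theorem seriesTmul_eq (a : A⟦X⟧) (b : B⟦X⟧) : seriesTmul 𝒜 ℬ a b =
    PowerSeries.map (GradedTensorProduct.includeLeft 𝒜 ℬ : A →+* _) a *
      PowerSeries.map (GradedTensorProduct.includeRight 𝒜 ℬ : B →+* _) b := by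
  ext n
  rw [seriesTmul, PowerSeries.coeff_mk, PowerSeries.coeff_mul]
  refine Finset.sum_congr rfl fun p _ => ?_
  simp only [PowerSeries.coeff_map]
  exact (GradedTensorProduct.tmul_one_mul_one_tmul 𝒜 ℬ _ _).symm

theorem includeRight_mul_includeLeft {p q : ℕ} {a : A} {b : B} (ha : a ∈ 𝒜 (p : ZMod 2))
    (hb : b ∈ ℬ (q : ZMod 2)) :
    GradedTensorProduct.includeRight 𝒜 ℬ b * GradedTensorProduct.includeLeft 𝒜 ℬ a =
      (-1) ^ (q * p) *
        (GradedTensorProduct.includeLeft 𝒜 ℬ a * GradedTensorProduct.includeRight 𝒜 ℬ b) := by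
  have h := GradedTensorProduct.tmul_coe_mul_coe_tmul 𝒜 ℬ (1 : A) ⟨b, hb⟩ ⟨a, ha⟩ (1 : B)
  simp only [one_mul, mul_one] at h
  refine h.trans ?_
  rw [← Nat.cast_mul, uzpow_natCast]
  have h2 : GradedTensorProduct.includeLeft 𝒜 ℬ a * GradedTensorProduct.includeRight 𝒜 ℬ b =
    GradedTensorProduct.tmul ℂ a b := GradedTensorProduct.tmul_one_mul_one_tmul 𝒜 ℬ _ _
  rw [h2]
  rcases Nat.even_or_odd (q * p) with h' | h'
  · simp [h'.neg_one_pow]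
  · simp [h'.neg_one_pow]

/-- The tensor product `f ⊗ g` of two even homomorphisms of superalgebras. -/
def superMap {A' B' : Type*} [Ring A'] [Ring B'] [Algebra ℂ A'] [Algebra ℂ B']
    (𝒜' : ZMod 2 → Submodule ℂ A') (ℬ' : ZMod 2 → Submodule ℂ B')
    [GradedAlgebra 𝒜'] [GradedAlgebra ℬ'] (f : A →ₐ[ℂ] A') (g : B →ₐ[ℂ] B')
    (hf : ∀ i, ∀ a ∈ 𝒜 i, f a ∈ 𝒜' i) (hg : ∀ i, ∀ b ∈ ℬ i, g b ∈ ℬ' i) :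
    GradedTensorProduct ℂ 𝒜 ℬ →ₐ[ℂ] GradedTensorProduct ℂ 𝒜' ℬ' :=
  GradedTensorProduct.lift 𝒜 ℬ ((GradedTensorProduct.includeLeft 𝒜' ℬ').comp f)
    ((GradedTensorProduct.includeRight 𝒜' ℬ').comp g) (by
      intro i j a b
      have h := GradedTensorProduct.tmul_coe_mul_coe_tmul 𝒜' ℬ'
        (1 : A') ⟨_, hg j b b.2⟩ ⟨_, hf i a a.2⟩ (1 : B')
      simp only [one_mul, mul_one] at h
      have h2 := GradedTensorProduct.tmul_one_mul_one_tmul 𝒜' ℬ' (R := ℂ) (f a) (g b)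
      refine h2.trans ?_
      refine Eq.trans ?_ (congrArg _ h).symm
      rw [smul_smul, Int.units_mul_self, one_smul])

theorem superMap_of {A' B' : Type*} [Ring A'] [Ring B'] [Algebra ℂ A'] [Algebra ℂ B']
    (𝒜' : ZMod 2 → Submodule ℂ A') (ℬ' : ZMod 2 → Submodule ℂ B')
    [GradedAlgebra 𝒜'] [GradedAlgebra ℬ'] (f : A →ₐ[ℂ] A') (g : B →ₐ[ℂ] B')
    (hf : ∀ i, ∀ a ∈ 𝒜 i, f a ∈ 𝒜' i) (hg : ∀ i, ∀ b ∈ ℬ i, g b ∈ ℬ' i) (z : A ⊗[ℂ] B) :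
    superMap 𝒜 ℬ 𝒜' ℬ' f g hf hg (GradedTensorProduct.of ℂ 𝒜 ℬ z) =
      GradedTensorProduct.of ℂ 𝒜' ℬ' (TensorProduct.map f.toLinearMap g.toLinearMap z) := by
  induction z using TensorProduct.induction_on with
  | zero => simp
  | tmul a b => exact GradedTensorProduct.tmul_one_mul_one_tmul 𝒜' ℬ' (R := ℂ) (f a) (g b)
  | add x y hx hy => simp only [map_add, hx, hy]

theorem map_superMap {A' B' : Type*} [Ring A'] [Ring B'] [Algebra ℂ A'] [Algebra ℂ B']
    (𝒜' : ZMod 2 → Submodule ℂ A') (ℬ' : ZMod 2 → Submodule ℂ B')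
    [GradedAlgebra 𝒜'] [GradedAlgebra ℬ'] (f : A →ₐ[ℂ] A') (g : B →ₐ[ℂ] B')
    (hf : ∀ i, ∀ a ∈ 𝒜 i, f a ∈ 𝒜' i) (hg : ∀ i, ∀ b ∈ ℬ i, g b ∈ ℬ' i) (a : A⟦X⟧) (b : B⟦X⟧) :
    PowerSeries.map (superMap 𝒜 ℬ 𝒜' ℬ' f g hf hg : GradedTensorProduct ℂ 𝒜 ℬ →+* _)
        (seriesTmul 𝒜 ℬ a b) =
      seriesTmul 𝒜' ℬ' (PowerSeries.map (f : A →+* A') a) (PowerSeries.map (g : B →+* B') b) := by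
  ext n
  rw [PowerSeries.coeff_map, seriesTmul, PowerSeries.coeff_mk, map_sum, seriesTmul,
    PowerSeries.coeff_mk]
  refine Finset.sum_congr rfl fun p _ => ?_
  exact superMap_of 𝒜 ℬ 𝒜' ℬ' f g hf hg _

end Graded

/-- The coproduct `Δ : t_{ij}(u) ↦ ∑_k t_{ik}(u) ⊗ t_{kj}(u)` of the extended Yangian. -/
def coproductX : ExtYangian →ₐ[ℂ] ExtYangianSq :=
  liftX (fun i j => ∑ k, seriesTmul (superPart parityX) (superPart parityX)
      (tSeries i k) (tSeries k j)) (by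
    intro i j
    simp only [seriesTmul_eq, map_sum, map_mul, ← PowerSeries.coeff_zero_eq_constantCoeff_apply,
      PowerSeries.coeff_map]
    simp only [PowerSeries.coeff_zero_eq_constantCoeff_apply, constantCoeff_tSeries, apply_ite,
      map_one, map_zero]
    fin_cases i <;> fin_cases j <;> simp) (by
    simp only [seriesTmul_eq]
    refine rttDefect_mul _ _ ?_ ?_ ?_
    · funext i j k l
      rw [← map₂_rttDefect, rttDefect_tSeries]; simp
    · funext i j k l
      rw [← map₂_rttDefect, rttDefect_tSeries]; simp
    · intro i j k l m n
      simp only [PowerSeries.coeff_map]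
      exact includeRight_mul_includeLeft _ _ (coeff_tSeries_mem k l n) (coeff_tSeries_mem i j m))

theorem map_coproductX (i j : Fin 3) :
    PowerSeries.map (coproductX : ExtYangian →+* ExtYangianSq) (tSeries i j) =
      ∑ k, seriesTmul (superPart parityX) (superPart parityX) (tSeries i k) (tSeries k j) :=
  map_liftX _ _ _ i j

/-! ### The Yangian -/

/-- The automorphism `t_{ij}(u) ↦ φ(u) t_{ij}(u)` for `φ(u) ∈ 1 + u⁻¹ ℂ[[u⁻¹]]`. -/
def mulAut (φ : {φ : ℂ⟦X⟧ // PowerSeries.constantCoeff φ = 1}) : ExtYangian →ₐ[ℂ] ExtYangian :=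
  liftX (fun i j => scalarSeries ExtYangian φ.1 * tSeries i j) (by
    intro i j
    rw [map_mul, constantCoeff_tSeries]
    have : PowerSeries.constantCoeff (scalarSeries ExtYangian φ.1) = 1 := by
      rw [scalarSeries, ← PowerSeries.coeff_zero_eq_constantCoeff_apply, PowerSeries.coeff_map,
        PowerSeries.coeff_zero_eq_constantCoeff_apply, φ.2, map_one]
    rw [this, one_mul]) (rttDefect_scalar _ _ rttDefect_tSeries)

theorem map_mulAut (φ : {φ : ℂ⟦X⟧ // PowerSeries.constantCoeff φ = 1}) (i j : Fin 3) :
    PowerSeries.map (mulAut φ : ExtYangian →+* ExtYangian) (tSeries i j) =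
      scalarSeries ExtYangian φ.1 * tSeries i j := map_liftX _ _ _ i j

/-- The Yangian `Y(osp(1|2))`: the subalgebra of the elements stable under all automorphisms
`t_{ij}(u) ↦ φ(u) t_{ij}(u)`. -/
def Yangian : Subalgebra ℂ ExtYangian where
  carrier := {x | ∀ φ, mulAut φ x = x}
  mul_mem' := by
    intro a b ha hb φ
    rw [map_mul, ha φ, hb φ]
  add_mem' := by
    intro a b ha hb φ
    rw [map_add, ha φ, hb φ]
  algebraMap_mem' := by
    intro c φ
    exact AlgHom.commutes _ c

theorem mem_yangian {x : ExtYangian} : x ∈ Yangian ↔ ∀ φ, mulAut φ x = x := Iff.rfl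

theorem map_scalarSeries {A B : Type*} [Ring A] [Algebra ℂ A] [Ring B] [Algebra ℂ B]
    (f : A →ₐ[ℂ] B) (φ : ℂ⟦X⟧) :
    PowerSeries.map (f : A →+* B) (scalarSeries A φ) = scalarSeries B φ := by
  ext n
  simp [scalarSeries]

theorem parityX_mulAut (φ : {φ : ℂ⟦X⟧ // PowerSeries.constantCoeff φ = 1}) (x : ExtYangian) :
    parityX (mulAut φ x) = mulAut φ (parityX x) := by
  have : parityX.comp (mulAut φ) = (mulAut φ).comp parityX := by
    apply extYangian_hom_ext
    intro i j
    rw [map_algHom_comp, map_algHom_comp, map_mulAut, map_mul, map_parityX, map_mul, map_mulAut,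
      map_scalarSeries, map_pow, map_neg, map_one, ← mul_assoc, scalarSeries_comm, mul_assoc]
  exact DFunLike.congr_fun this x

/-- The parity automorphism of the Yangian. -/
def parityY : Yangian →ₐ[ℂ] Yangian :=
  AlgHom.codRestrict (parityX.comp Yangian.val) Yangian (by
    intro x φ
    have h : mulAut φ x = (x : ExtYangian) := x.2 φ
    change mulAut φ (parityX x) = parityX x
    rw [← parityX_mulAut, h])

theorem coe_parityY (x : Yangian) : (parityY x : ExtYangian) = parityX x := rfl

theorem parityY_parityY (x : Yangian) : parityY (parityY x) = x :=
  Subtype.ext (parityX_parityX x)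

instance : GradedAlgebra (superPart parityY) := superGradedAlgebra parityY parityY_parityY

/-- The tensor product `Y(osp(1|2)) ⊗ Y(osp(1|2))` of superalgebras. -/
abbrev YangianSq : Type :=
  GradedTensorProduct ℂ (superPart parityY) (superPart parityY)

theorem coe_mem_superPart (i : ZMod 2) (a : Yangian) (ha : a ∈ superPart parityY i) :
    Yangian.val a ∈ superPart parityX i := by
  rw [mem_superPart] at ha ⊢
  exact (coe_parityY a).symm.trans (congrArg _ ha)

/-- The embedding of `Y ⊗ Y` into `X ⊗ X`. -/
def inclSq : YangianSq →ₐ[ℂ] ExtYangianSq :=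
  superMap (superPart parityY) (superPart parityY) (superPart parityX) (superPart parityX)
    Yangian.val Yangian.val coe_mem_superPart coe_mem_superPart

theorem inclSq_of (z : Yangian ⊗[ℂ] Yangian) :
    inclSq (GradedTensorProduct.of ℂ (superPart parityY) (superPart parityY) z) =
      GradedTensorProduct.of ℂ (superPart parityX) (superPart parityX)
        (TensorProduct.map Yangian.val.toLinearMap Yangian.val.toLinearMap z) :=
  superMap_of _ _ _ _ _ _ _ _ z

theorem inclSq_injective : Function.Injective inclSq := by
  intro x y h
  have hi : Function.Injective Yangian.val.toLinearMap := Subtype.val_injective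
  have hm : Function.Injective
      (TensorProduct.map Yangian.val.toLinearMap Yangian.val.toLinearMap) :=
    TensorProduct.map_injective_of_flat_flat _ _ hi hi
  exact hm (((inclSq_of x).symm.trans h).trans (inclSq_of y))

section Invariants

variable {I V W : Type*} [AddCommGroup V] [Module ℂ V] [AddCommGroup W] [Module ℂ W]

theorem exists_rTensor (f : I → V →ₗ[ℂ] V) (K : Submodule ℂ V) (hK : ∀ x, x ∈ K ↔ ∀ a, f a x = x)
    (z : V ⊗[ℂ] W) (hz : ∀ a, (f a).rTensor W z = z) : ∃ w, K.subtype.rTensor W w = z := by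
  let b := Module.Basis.ofVectorSpace ℂ W
  obtain ⟨c, hc⟩ := TensorProduct.eq_repr_basis_right b z
  have hmem : ∀ i, c i ∈ K := by
    classical
    intro i
    rw [hK]
    intro a
    have h1 := hz a
    rw [← hc, Finsupp.sum, map_sum] at h1
    simp only [LinearMap.rTensor_tmul] at h1
    have h2 := congrArg (fun t => (TensorProduct.equivFinsuppOfBasisRight b) t i) h1
    have h3 : ∀ (g : Module.Basis.ofVectorSpaceIndex ℂ W → V),
        (TensorProduct.equivFinsuppOfBasisRight b) (∑ j ∈ c.support, g j ⊗ₜ[ℂ] b j) i =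
          ∑ j ∈ c.support, if j = i then g j else 0 := by
      intro g
      rw [map_sum, Finsupp.finsetSum_apply]
      refine Finset.sum_congr rfl fun j _ => ?_
      simp [Finsupp.single_apply]
    simp only [h3] at h2
    rw [Finset.sum_ite_eq', Finset.sum_ite_eq'] at h2
    by_cases hi : i ∈ c.support
    · simpa [hi] using h2
    · simp [Finsupp.notMem_support_iff.mp hi]
  refine ⟨∑ i ∈ c.support, (⟨c i, hmem i⟩ : K) ⊗ₜ[ℂ] b i, ?_⟩
  rw [map_sum]
  simpa [Finsupp.sum] using hc

theorem exists_lTensor (f : I → V →ₗ[ℂ] V) (K : Submodule ℂ V) (hK : ∀ x, x ∈ K ↔ ∀ a, f a x = x)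
    (z : W ⊗[ℂ] V) (hz : ∀ a, (f a).lTensor W z = z) : ∃ w, K.subtype.lTensor W w = z := by
  obtain ⟨w, hw⟩ := exists_rTensor f K hK (TensorProduct.comm ℂ W V z) (by
    intro a
    rw [LinearMap.rTensor_comm, hz a])
  refine ⟨TensorProduct.comm ℂ K W w, ?_⟩
  rw [LinearMap.lTensor_comm, hw]
  simp

end Invariants

theorem id_mem_superPart (i : ZMod 2) (a : ExtYangian) (ha : a ∈ superPart parityX i) :
    AlgHom.id ℂ ExtYangian a ∈ superPart parityX i := ha

theorem mulAut_mem_superPart (φ : {φ : ℂ⟦X⟧ // PowerSeries.constantCoeff φ = 1}) (i : ZMod 2)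
    (a : ExtYangian) (ha : a ∈ superPart parityX i) : mulAut φ a ∈ superPart parityX i := by
  rw [mem_superPart] at ha ⊢
  rw [parityX_mulAut, ha, map_smul]

theorem seriesTmul_scalar_left {A B : Type*} [Ring A] [Ring B] [Algebra ℂ A] [Algebra ℂ B]
    (𝒜 : ZMod 2 → Submodule ℂ A) (ℬ : ZMod 2 → Submodule ℂ B) [GradedAlgebra 𝒜] [GradedAlgebra ℬ]
    (φ : ℂ⟦X⟧) (a : A⟦X⟧) (b : B⟦X⟧) : seriesTmul 𝒜 ℬ (scalarSeries A φ * a) b =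
      scalarSeries _ φ * seriesTmul 𝒜 ℬ a b := by
  rw [seriesTmul_eq, seriesTmul_eq, map_mul, map_scalarSeries, mul_assoc]

theorem seriesTmul_scalar_right {A B : Type*} [Ring A] [Ring B] [Algebra ℂ A] [Algebra ℂ B]
    (𝒜 : ZMod 2 → Submodule ℂ A) (ℬ : ZMod 2 → Submodule ℂ B) [GradedAlgebra 𝒜] [GradedAlgebra ℬ]
    (φ : ℂ⟦X⟧) (a : A⟦X⟧) (b : B⟦X⟧) : seriesTmul 𝒜 ℬ a (scalarSeries B φ * b) =
      scalarSeries _ φ * seriesTmul 𝒜 ℬ a b := by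
  rw [seriesTmul_eq, seriesTmul_eq, map_mul, map_scalarSeries, ← mul_assoc, ← scalarSeries_comm,
    mul_assoc]

theorem coproductX_mulAut_left (φ : {φ : ℂ⟦X⟧ // PowerSeries.constantCoeff φ = 1})
    (x : ExtYangian) : coproductX (mulAut φ x) =
      superMap (superPart parityX) (superPart parityX) (superPart parityX) (superPart parityX)
        (mulAut φ) (AlgHom.id ℂ _) (mulAut_mem_superPart φ) id_mem_superPart (coproductX x) := by
  refine DFunLike.congr_fun (f := coproductX.comp (mulAut φ)) (g := AlgHom.comp
    (superMap (superPart parityX) (superPart parityX) (superPart parityX) (superPart parityX)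
        (mulAut φ) (AlgHom.id ℂ _) (mulAut_mem_superPart φ) id_mem_superPart) coproductX) ?_ x
  apply extYangian_hom_ext
  intro i j
  rw [map_algHom_comp, map_algHom_comp, map_mulAut, map_mul, map_coproductX, map_scalarSeries,
    map_sum]
  simp only [map_superMap, map_mulAut, map_algHom_id, seriesTmul_scalar_left, Finset.mul_sum]

theorem coproductX_mulAut_right (φ : {φ : ℂ⟦X⟧ // PowerSeries.constantCoeff φ = 1})
    (x : ExtYangian) : coproductX (mulAut φ x) =
      superMap (superPart parityX) (superPart parityX) (superPart parityX) (superPart parityX)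
        (AlgHom.id ℂ _) (mulAut φ) id_mem_superPart (mulAut_mem_superPart φ) (coproductX x) := by
  refine DFunLike.congr_fun (f := coproductX.comp (mulAut φ)) (g := AlgHom.comp
    (superMap (superPart parityX) (superPart parityX) (superPart parityX) (superPart parityX)
        (AlgHom.id ℂ _) (mulAut φ) id_mem_superPart (mulAut_mem_superPart φ)) coproductX) ?_ x
  apply extYangian_hom_ext
  intro i j
  rw [map_algHom_comp, map_algHom_comp, map_mulAut, map_mul, map_coproductX, map_scalarSeries,
    map_sum]
  simp only [map_superMap, map_mulAut, map_algHom_id, seriesTmul_scalar_right, Finset.mul_sum]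

theorem coproductX_mem_range (x : Yangian) : coproductX x ∈ inclSq.range := by
  let z : ExtYangian ⊗[ℂ] ExtYangian :=
    (GradedTensorProduct.of ℂ (superPart parityX) (superPart parityX)).symm (coproductX x)
  have hz : coproductX x = GradedTensorProduct.of ℂ (superPart parityX) (superPart parityX) z := rfl
  have hl : ∀ φ, (mulAut φ).toLinearMap.rTensor ExtYangian z = z := by
    intro φ
    have h := coproductX_mulAut_left φ x
    rw [x.2 φ, hz, superMap_of] at h
    exact h.symm
  have hr : ∀ φ, (mulAut φ).toLinearMap.lTensor ExtYangian z = z := by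
    intro φ
    have h := coproductX_mulAut_right φ x
    rw [x.2 φ, hz, superMap_of] at h
    exact h.symm
  obtain ⟨w, hw⟩ := exists_rTensor (fun φ => (mulAut φ).toLinearMap) (Subalgebra.toSubmodule Yangian)
    (fun x => mem_yangian) z hl
  obtain ⟨t, ht⟩ := exists_lTensor (fun φ => (mulAut φ).toLinearMap) (Subalgebra.toSubmodule Yangian)
    (fun x => mem_yangian) w (by
      intro φ
      apply Module.Flat.rTensor_preserves_injective_linearMap
        (Subalgebra.toSubmodule Yangian).subtype Subtype.val_injective
      rw [hw, ← LinearMap.comp_apply, LinearMap.rTensor_comp_lTensor,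
        ← LinearMap.lTensor_comp_rTensor, LinearMap.comp_apply, hw]
      exact hr φ)
  refine ⟨GradedTensorProduct.of ℂ (superPart parityY) (superPart parityY) t, ?_⟩
  refine (inclSq_of t).trans ?_
  rw [hz, ← hw, ← ht, ← LinearMap.comp_apply, LinearMap.rTensor_comp_lTensor]
  rfl

/-- The coproduct of the Yangian: the restriction of the coproduct of the extended Yangian, which
maps `Y` to `Y ⊗ Y`. -/
def coproductY : Yangian →ₐ[ℂ] YangianSq :=
  (AlgEquiv.ofInjective inclSq inclSq_injective).symm.toAlgHom.comp
    (AlgHom.codRestrict (coproductX.comp Yangian.val) inclSq.range coproductX_mem_range)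

theorem inclSq_coproductY (x : Yangian) : inclSq (coproductY x) = coproductX x :=
  congrArg Subtype.val ((AlgEquiv.ofInjective inclSq inclSq_injective).apply_symm_apply
    ⟨coproductX x, coproductX_mem_range x⟩)

/-! ### Gaussian generators -/

/-- The inverse of a series in `u⁻¹` with constant term `1`. -/
def invSeries {A : Type*} [Ring A] (a : A⟦X⟧) : A⟦X⟧ := PowerSeries.invOfUnit a 1

theorem mul_invSeries {A : Type*} [Ring A] (a : A⟦X⟧) (h : PowerSeries.constantCoeff a = 1) :
    a * invSeries a = 1 := PowerSeries.mul_invOfUnit a 1 h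

theorem invSeries_mul {A : Type*} [Ring A] (a : A⟦X⟧) (h : PowerSeries.constantCoeff a = 1) :
    invSeries a * a = 1 := PowerSeries.invOfUnit_mul a 1 h

/-- `h₁(u) = t₁₁(u)`. -/
def h₁X : ExtYangian⟦X⟧ := tSeries 0 0

/-- `h₂(u) = t₂₂(u) - t₂₁(u) t₁₁(u)⁻¹ t₁₂(u)`. -/
def h₂X : ExtYangian⟦X⟧ := tSeries 1 1 - tSeries 1 0 * invSeries (tSeries 0 0) * tSeries 0 1

/-- `k(u) = h₁(u)⁻¹ h₂(u)`. -/
def kX : ExtYangian⟦X⟧ := invSeries h₁X * h₂X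

/-- `e_{1j}(u) = h₁(u)⁻¹ t_{1j}(u)` for `j = 2, 1'`. -/
def eX (j : Fin 3) : ExtYangian⟦X⟧ := invSeries h₁X * tSeries 0 j

/-- `f_{j1}(u) = t_{j1}(u) h₁(u)⁻¹` for `j = 2, 1'`. -/
def fX (j : Fin 3) : ExtYangian⟦X⟧ := tSeries j 0 * invSeries h₁X

theorem constantCoeff_h₁X : PowerSeries.constantCoeff h₁X = 1 := by
  rw [h₁X, constantCoeff_tSeries, if_pos rfl]

theorem invSeries_unique {A : Type*} [Ring A] {a b : A⟦X⟧}
    (h : PowerSeries.constantCoeff a = 1) (hab : b * a = 1) : invSeries a = b := by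
  rw [← one_mul (invSeries a), ← hab, mul_assoc, mul_invSeries a h, mul_one]

theorem constantCoeff_scalarSeries (φ : {φ : ℂ⟦X⟧ // PowerSeries.constantCoeff φ = 1}) :
    PowerSeries.constantCoeff (scalarSeries ExtYangian φ.1) = 1 := by
  rw [scalarSeries, ← PowerSeries.coeff_zero_eq_constantCoeff_apply, PowerSeries.coeff_map,
    PowerSeries.coeff_zero_eq_constantCoeff_apply, φ.2, map_one]

theorem map_mulAut_invSeries (φ : {φ : ℂ⟦X⟧ // PowerSeries.constantCoeff φ = 1}) :
    PowerSeries.map (mulAut φ : ExtYangian →+* ExtYangian) (invSeries h₁X) *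
      scalarSeries ExtYangian φ.1 = invSeries h₁X := by
  refine (invSeries_unique constantCoeff_h₁X ?_).symm
  have h := map_mulAut φ 0 0
  rw [mul_assoc]
  have h2 : scalarSeries ExtYangian φ.1 * h₁X =
    PowerSeries.map (mulAut φ : ExtYangian →+* ExtYangian) h₁X := h.symm
  rw [h2, ← map_mul, invSeries_mul _ constantCoeff_h₁X, map_one]

theorem coeff_mem_yangian {a : ExtYangian⟦X⟧}
    (h : ∀ φ, PowerSeries.map (mulAut φ : ExtYangian →+* ExtYangian) a = a) (n : ℕ) :
    PowerSeries.coeff n a ∈ Yangian := by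
  intro φ
  have := congrArg (PowerSeries.coeff n) (h φ)
  rwa [PowerSeries.coeff_map] at this

theorem coeff_eX_mem (j : Fin 3) (n : ℕ) : PowerSeries.coeff n (eX j) ∈ Yangian := by
  refine coeff_mem_yangian (fun φ => ?_) n
  rw [eX, map_mul, map_mulAut, ← mul_assoc, map_mulAut_invSeries]

theorem coeff_fX_mem (j : Fin 3) (n : ℕ) : PowerSeries.coeff n (fX j) ∈ Yangian := by
  refine coeff_mem_yangian (fun φ => ?_) n
  rw [fX, map_mul, map_mulAut, scalarSeries_comm, mul_assoc, scalarSeries_comm,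
    map_mulAut_invSeries]

theorem coeff_kX_mem (n : ℕ) : PowerSeries.coeff n kX ∈ Yangian := by
  refine coeff_mem_yangian (fun φ => ?_) n
  have h : PowerSeries.map (mulAut φ : ExtYangian →+* ExtYangian) h₂X =
      scalarSeries ExtYangian φ.1 * h₂X := by
    have h3 := map_mulAut_invSeries φ
    rw [h₁X] at h3
    rw [h₂X, map_sub, map_mul, map_mul, map_mulAut, map_mulAut, map_mulAut, mul_sub]
    conv_rhs => rw [← h3]
    simp only [mul_assoc]
  rw [kX, map_mul, h, ← mul_assoc, map_mulAut_invSeries]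

/-- A series over `X` whose coefficients lie in `Y`, viewed as a series over `Y`. -/
def toY (a : ExtYangian⟦X⟧) (h : ∀ n, PowerSeries.coeff n a ∈ Yangian) : Yangian⟦X⟧ :=
  PowerSeries.mk fun n => ⟨PowerSeries.coeff n a, h n⟩

/-- The series `k(u)` over the Yangian. -/
def kY : Yangian⟦X⟧ := toY kX coeff_kX_mem

/-- The series `e(u) = e_{12}(u)` over the Yangian. -/
def eY : Yangian⟦X⟧ := toY (eX 1) (coeff_eX_mem 1)

/-- The series `e_{11'}(u)` over the Yangian. -/
def e₁₁Y : Yangian⟦X⟧ := toY (eX 2) (coeff_eX_mem 2)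

/-- The series `f(u) = f_{21}(u)` over the Yangian. -/
def fY : Yangian⟦X⟧ := toY (fX 1) (coeff_fX_mem 1)

/-- The series `f_{1'1}(u)` over the Yangian. -/
def f₁₁Y : Yangian⟦X⟧ := toY (fX 2) (coeff_fX_mem 2)

/-- The series `a(u + c)` re-expanded in `u⁻¹`: each `u^{-r}` is replaced by
`(u + c)^{-r} = (u⁻¹ (1 + c u⁻¹)⁻¹)^r`, which has no terms of degree less than `r` in `u⁻¹`. -/
def shift {A : Type*} [Ring A] [Algebra ℂ A] (c : ℂ) (a : A⟦X⟧) : A⟦X⟧ := PowerSeries.mk fun n =>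
  ∑ r ∈ Finset.range (n + 1),
    PowerSeries.coeff n ((PowerSeries.X * (1 + PowerSeries.C c * PowerSeries.X)⁻¹ : ℂ⟦X⟧) ^ r) •
      PowerSeries.coeff r a

/-- The series `∑_{r ≥ 0} a_r` of formal power series converges to `s`: every coefficient of the
partial sums is eventually equal to that of `s`. -/
def HasFormalSum {A : Type*} [Ring A] (a : ℕ → A⟦X⟧) (s : A⟦X⟧) : Prop :=
  ∀ n, ∃ N, ∀ M ≥ N, PowerSeries.coeff n (∑ r ∈ Finset.range M, a r) = PowerSeries.coeff n s

/-- The image under the coproduct of a series over the Yangian, taken coefficientwise. -/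
def deltaSeries (a : Yangian⟦X⟧) : YangianSq⟦X⟧ :=
  PowerSeries.map (coproductY : Yangian →+* YangianSq) a

/-- The series `a(u) ⊗ b(u)` over `Y ⊗ Y`. -/
def tmulY (a b : Yangian⟦X⟧) : YangianSq⟦X⟧ :=
  seriesTmul (superPart parityY) (superPart parityY) a b

end OspYangian

end

open OspYangian

/-! Write `h = h₁(u)`. The coproduct gives `Δ(h) = h ⊗ h + t₁₂ ⊗ t₂₁ + t₁₁' ⊗ t₁'₁`. Since `h` is
even, `h ⊗ h` can be pulled out on the left, leaving `1 + W` with `W = e ⊗ h⁻¹t₂₁ + e₁₁' ⊗ h⁻¹t₁'₁`.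
Also `Δ(e) = Δ(h)⁻¹ Δ(t₁₂)`, and in `Δ(t₁₂) - Δ(h)(1 ⊗ e)` the term `h ⊗ t₁₂` cancels. What remains
is `t₁₂ ⊗ h₂ + t₁₁' ⊗ (t₁'₂ - t₁'₁ e)`. The formula for `Δ(e)` is thus `(1 + W)⁻¹`, expanded as a
geometric series, times this remainder divided by `h ⊗ h`. The formula for `Δ(f)` is the mirror
image, with `h ⊗ h` pulled out on the right.

It remains to express the products with `h⁻¹` through shifted Gaussian series. All of these come
from the `RTT` relation with `u - v` specialised to a constant. At `u - v = -1` the coefficients of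
`1` and `-P` in the cleared `R`-matrix are opposite, which gives `h⁻¹t₂₁ = f(u + 1)` and `h⁻¹t₁'₁ =
f₁'₁(u + 1) - 2f(u + 1)²` (`h₁X_mul_shift_f`, `h₁X_mul_shift_f₁₁`). At `u - v = κ` only `Q`
survives, which gives `t₁'₂ - t₁'₁ e = f(u - 1/2) h₂` (`lower_quasidet`). At `u - v = 1/2` one finds
`h⁻¹ f(u - 1/2) h = f(u - 1/2)/3 + 2f(u + 1)/3` (`h₁X_mul_half_f`). For `Δ(f)` one needs in addition
that `h₁` and `h₂` commute (`h₁X_comm_h₂X`), which is proved with two independent variables.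

The identities are established in `X ⊗ X` (`deltaX_eX`, `deltaX_fX`) and pulled back along the
injection of `Y ⊗ Y`. -/

noncomputable section

namespace OspYangian

/-! ### Substituting a central series without constant term for the outer variable. -/

section Evaluation

variable {A : Type*} [Ring A]

theorem coeff_pow_of_lt {p : A⟦X⟧} (hp0 : PowerSeries.constantCoeff p = 0) {n m : ℕ} (h : n < m) :
    PowerSeries.coeff n (p ^ m) = 0 :=
  PowerSeries.coeff_of_lt_order _ (lt_of_lt_of_le (by exact_mod_cast h)
    (PowerSeries.le_order_pow_of_constantCoeff_eq_zero m hp0))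

theorem coeff_mul_pow_of_lt {p : A⟦X⟧} (hp0 : PowerSeries.constantCoeff p = 0) (a : A⟦X⟧)
    {n m : ℕ} (h : n < m) : PowerSeries.coeff n (a * p ^ m) = 0 := by
  rw [PowerSeries.coeff_mul]
  refine Finset.sum_eq_zero fun x hx => ?_
  rw [Finset.HasAntidiagonal.mem_antidiagonal] at hx
  rw [coeff_pow_of_lt hp0 (by omega), mul_zero]

/-- The series `∑ F_m p^m`, for a series `F` in two variables with coefficients `F_m` and `p`
without constant term. -/
def evalFun (p : A⟦X⟧) (F : A⟦X⟧⟦X⟧) : A⟦X⟧ := PowerSeries.mk fun n =>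
  ∑ m ∈ Finset.range (n + 1), PowerSeries.coeff n (PowerSeries.coeff m F * p ^ m)

theorem coeff_evalFun {p : A⟦X⟧} (hp0 : PowerSeries.constantCoeff p = 0) (F : A⟦X⟧⟦X⟧) {n N : ℕ}
    (h : n < N) : PowerSeries.coeff n (evalFun p F) =
      ∑ m ∈ Finset.range N, PowerSeries.coeff n (PowerSeries.coeff m F * p ^ m) := by
  rw [evalFun, PowerSeries.coeff_mk]
  refine Finset.sum_subset (Finset.range_subset_range.mpr h) fun m _ hm => ?_
  exact coeff_mul_pow_of_lt hp0 _ (by simpa using hm)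

theorem evalFun_mul {p : A⟦X⟧} (hp : ∀ a, p * a = a * p) (hp0 : PowerSeries.constantCoeff p = 0)
    (F G : A⟦X⟧⟦X⟧) : evalFun p (F * G) = evalFun p F * evalFun p G := by
  have hpow : ∀ m a, p ^ m * a = a * p ^ m := fun m a =>
    (show Commute p a from hp a).pow_left m |>.eq
  ext n
  have hR : PowerSeries.coeff n (evalFun p F * evalFun p G) =
      ∑ i ∈ Finset.range (n + 1), ∑ j ∈ Finset.range (n + 1),
        PowerSeries.coeff n (PowerSeries.coeff i F * PowerSeries.coeff j G * p ^ (i + j)) := by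
    have h1 : PowerSeries.coeff n (evalFun p F * evalFun p G) =
        PowerSeries.coeff n ((∑ i ∈ Finset.range (n + 1), PowerSeries.coeff i F * p ^ i) *
          (∑ j ∈ Finset.range (n + 1), PowerSeries.coeff j G * p ^ j)) := by
      rw [PowerSeries.coeff_mul, PowerSeries.coeff_mul]
      refine Finset.sum_congr rfl fun x hx => ?_
      rw [Finset.HasAntidiagonal.mem_antidiagonal] at hx
      rw [coeff_evalFun hp0 F (show x.1 < n + 1 by omega),
        coeff_evalFun hp0 G (show x.2 < n + 1 by omega), map_sum, map_sum]
    rw [h1, Finset.sum_mul_sum, map_sum]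
    refine Finset.sum_congr rfl fun i _ => ?_
    rw [map_sum]
    refine Finset.sum_congr rfl fun j _ => ?_
    rw [mul_assoc, ← mul_assoc (p ^ i), hpow, pow_add]
    simp only [mul_assoc]
  rw [hR, coeff_evalFun hp0 _ (Nat.lt_succ_self n)]
  simp only [PowerSeries.coeff_mul (R := A⟦X⟧), Finset.sum_mul, map_sum]
  -- The left side runs over antidiagonals `i + j = m ≤ n`, the right side over the square `i, j ≤
  -- n`. The extra pairs have `i + j > n`, and there `p ^ (i + j)` has no coefficient of degree `n`.
  rw [Finset.sum_sigma', ← Finset.sum_product']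
  refine Finset.sum_bij_ne_zero (fun x _ _ => x.2) ?_ ?_ ?_ ?_
  · rintro ⟨m, i, j⟩ h _
    simp only [Finset.mem_sigma, Finset.mem_range, Finset.HasAntidiagonal.mem_antidiagonal,
      Finset.mem_product] at h ⊢
    omega
  · rintro ⟨m, i, j⟩ h _ ⟨m', i', j'⟩ h' _ e
    simp only [Finset.mem_sigma, Finset.mem_range, Finset.HasAntidiagonal.mem_antidiagonal] at h h'
    simp only [Prod.mk.injEq] at e
    obtain ⟨rfl, rfl⟩ := e
    obtain ⟨_, rfl⟩ := h
    obtain ⟨_, rfl⟩ := h'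
    rfl
  · rintro ⟨i, j⟩ h hne
    by_cases hij : n < i + j
    · exact absurd (coeff_mul_pow_of_lt hp0 _ hij) hne
    · refine ⟨⟨i + j, i, j⟩, ?_, hne, rfl⟩
      simp only [Finset.mem_sigma, Finset.mem_range, Finset.HasAntidiagonal.mem_antidiagonal,
        and_true]
      omega
  · rintro ⟨m, i, j⟩ h _
    simp only [Finset.mem_sigma, Finset.mem_range, Finset.HasAntidiagonal.mem_antidiagonal] at h
    rw [h.2]

theorem evalFun_C (p a : A⟦X⟧) : evalFun p (PowerSeries.C a) = a := by
  ext n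
  rw [evalFun, PowerSeries.coeff_mk, Finset.sum_eq_single 0]
  · simp
  · intro m _ hm
    rw [PowerSeries.coeff_C, if_neg hm, zero_mul, map_zero]
  · simp

/-- The evaluation of the outer variable at a central series without constant term. -/
def evalHom (p : A⟦X⟧) (hp : ∀ a, p * a = a * p) (hp0 : PowerSeries.constantCoeff p = 0) :
    A⟦X⟧⟦X⟧ →+* A⟦X⟧ where
  toFun := evalFun p
  map_one' := by rw [← map_one PowerSeries.C, evalFun_C]
  map_zero' := by rw [← map_zero PowerSeries.C, evalFun_C]
  map_add' F G := by
    ext n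
    simp only [evalFun, PowerSeries.coeff_mk, map_add, add_mul, Finset.sum_add_distrib]
  map_mul' := evalFun_mul hp hp0

variable {p : A⟦X⟧} (hp : ∀ a, p * a = a * p) (hp0 : PowerSeries.constantCoeff p = 0)

theorem evalHom_C (a : A⟦X⟧) : evalHom p hp hp0 (PowerSeries.C a) = a := evalFun_C p a

theorem evalHom_X : evalHom p hp hp0 PowerSeries.X = p := by
  ext n
  refine (coeff_evalFun hp0 _ (show n < n + 2 by omega)).trans ?_
  rw [Finset.sum_eq_single 1]
  · simp
  · intro m _ hm
    rw [PowerSeries.coeff_X, if_neg hm, zero_mul, map_zero]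
  · simp

end Evaluation

/-! ### The shift `u ↦ u + c` as a ring homomorphism. -/

section Shift

variable {A : Type*} [Ring A] [Algebra ℂ A]

/-- The expansion `(u + c)⁻¹ = u⁻¹ (1 + c u⁻¹)⁻¹`. -/
def shiftInv (c : ℂ) : ℂ⟦X⟧ := PowerSeries.X * (1 + PowerSeries.C c * PowerSeries.X)⁻¹

theorem shiftInv_mul (c : ℂ) :
    shiftInv c * (1 + PowerSeries.C c * PowerSeries.X) = PowerSeries.X := by
  rw [shiftInv, mul_assoc, PowerSeries.inv_mul_cancel, mul_one]
  simp

theorem constantCoeff_shiftInv (c : ℂ) : PowerSeries.constantCoeff (shiftInv c) = 0 := by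
  simp [shiftInv]

/-- The partial fraction identity for `(u + a)⁻¹` and `(u + b)⁻¹`. It makes the specialised `v⁻¹ -
u⁻¹` a constant multiple of the specialised `u⁻¹ v⁻¹`. -/
theorem shiftInv_sub (a b : ℂ) :
    shiftInv b - shiftInv a = PowerSeries.C (a - b) * (shiftInv a * shiftInv b) := by
  have h1 : ∀ c : ℂ, (1 + PowerSeries.C c * PowerSeries.X : ℂ⟦X⟧) ≠ 0 := by
    intro c h
    have := congrArg PowerSeries.constantCoeff h
    simp at this
  have ha := shiftInv_mul a
  have hb := shiftInv_mul b
  refine mul_right_cancel₀ (h1 a) (mul_right_cancel₀ (h1 b) ?_)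
  rw [map_sub]
  linear_combination (1 + PowerSeries.C a * PowerSeries.X) * hb -
    (1 + PowerSeries.C b * PowerSeries.X) * ha -
    (PowerSeries.C a - PowerSeries.C b) * PowerSeries.X * hb -
    (PowerSeries.C a - PowerSeries.C b) * shiftInv b * (1 + PowerSeries.C b * PowerSeries.X) * ha

theorem constantCoeff_map_scalar (φ : ℂ⟦X⟧) (h : PowerSeries.constantCoeff φ = 0) :
    PowerSeries.constantCoeff (scalarSeries A φ) = 0 := by
  rw [scalarSeries, ← PowerSeries.coeff_zero_eq_constantCoeff_apply, PowerSeries.coeff_map,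
    PowerSeries.coeff_zero_eq_constantCoeff_apply, h, map_zero]

variable (A)

/-- The evaluation of the outer variable `u⁻¹` at `(u + c)⁻¹`. -/
def evalShift (c : ℂ) : A⟦X⟧⟦X⟧ →+* A⟦X⟧ :=
  evalHom (scalarSeries A (shiftInv c)) (scalarSeries_comm _)
    (constantCoeff_map_scalar _ (constantCoeff_shiftInv c))

/-- The shift `a(u) ↦ a(u + c)` as a ring homomorphism. -/
def shiftHom (c : ℂ) : A⟦X⟧ →+* A⟦X⟧ := (evalShift A c).comp (PowerSeries.map (PowerSeries.C (R := A)))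

variable {A}

theorem shiftHom_apply (c : ℂ) (a : A⟦X⟧) : shiftHom A c a = shift c a := by
  ext n
  change PowerSeries.coeff n (evalFun (scalarSeries A (shiftInv c))
    (PowerSeries.map (PowerSeries.C (R := A)) a)) = _
  rw [evalFun, PowerSeries.coeff_mk, shift, PowerSeries.coeff_mk]
  refine Finset.sum_congr rfl fun r _ => ?_
  rw [PowerSeries.coeff_map, PowerSeries.coeff_C_mul, ← map_pow, scalarSeries,
    PowerSeries.coeff_map, ← Algebra.commutes, ← Algebra.smul_def]
  rfl

theorem shift_mul (c : ℂ) (a b : A⟦X⟧) : shift c (a * b) = shift c a * shift c b := by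
  simp only [← shiftHom_apply, map_mul]

theorem shift_one (c : ℂ) : shift c (1 : A⟦X⟧) = 1 := by
  simp only [← shiftHom_apply, map_one]

theorem shift_zero (a : A⟦X⟧) : shift 0 a = a := by
  ext n
  simp only [shift, PowerSeries.coeff_mk, map_zero, zero_mul, add_zero]
  rw [Finset.sum_eq_single n]
  · rw [inv_one]
    simp
  · intro m _ hm
    rw [inv_one]
    simp [PowerSeries.coeff_X_pow, Ne.symm hm]
  · simp

theorem shiftHom_scalarSeries_X (c : ℂ) :
    shiftHom A c (PowerSeries.X) = scalarSeries A (shiftInv c) := by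
  simp only [shiftHom, RingHom.comp_apply, PowerSeries.map_X]
  exact evalHom_X _ _

end Shift

/-! ### The `RTT` relation with `u - v` equal to a constant. -/

section Specialisation

variable {A : Type*} [Ring A] [Algebra ℂ A]

/-- The element `r₀ - r₁ P + r₂ Q` of `End ℂ^{1|2} ⊗ End ℂ^{1|2} ⊗ A`. -/
def rTens (r₀ r₁ r₂ : A) : Tens A := fun i j k l =>
  r₀ * tensOne i j k l - r₁ * tensP i j k l + r₂ * tensQ i j k l

/-- The relation `(r₀ - r₁ P + r₂ Q) S₁ U₂ = U₂ S₁ (r₀ - r₁ P + r₂ Q)`. -/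
def RTT (r₀ r₁ r₂ : A) (S U : Fin 3 → Fin 3 → A) : Prop :=
  tensMul (tensMul (rTens r₀ r₁ r₂) (tensFst S)) (tensSnd U) =
    tensMul (tensMul (tensSnd U) (tensFst S)) (rTens r₀ r₁ r₂)

theorem scalarSeries_C (c : ℂ) :
    scalarSeries A (PowerSeries.C c) = algebraMap ℂ A⟦X⟧ c := by
  rw [scalarSeries, PowerSeries.map_C, PowerSeries.algebraMap_apply]

/-- `X` is a multiple of `shiftInv c`, so regularity follows from that of `X`. -/
theorem scalar_shiftInv_regular {c : ℂ} {F : A⟦X⟧}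
    (h : scalarSeries A (shiftInv c) * F = 0) : F = 0 := by
  have h1 : (PowerSeries.X : A⟦X⟧) * F = 0 := by
    have h2 : (PowerSeries.X : A⟦X⟧) = scalarSeries A PowerSeries.X := by
      rw [scalarSeries, PowerSeries.map_X]
    rw [h2, ← shiftInv_mul c, mul_comm (shiftInv c), map_mul, mul_assoc, h, mul_zero]
  ext n
  have := congrArg (PowerSeries.coeff (n + 1)) h1
  rwa [PowerSeries.coeff_succ_X_mul] at this

variable (A)

/-- The specialisation `u ↦ u + a`, `v ↦ u + b` of series in two variables. -/
def evalShift₂ (a b : ℂ) : A⟦X⟧⟦X⟧ →+* A⟦X⟧ :=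
  -- The inner variable `v⁻¹` is first replaced by `(u + b)⁻¹`, so that from then on the inner `X`
  -- stands for `u⁻¹`. The outer variable is then evaluated at `(u + a)⁻¹`.
  (evalShift A a).comp (PowerSeries.map (shiftHom A b))

variable {A}

theorem shiftHom_C (c : ℂ) (x : A) : shiftHom A c (PowerSeries.C x) = PowerSeries.C x := by
  simp only [shiftHom, RingHom.comp_apply, PowerSeries.map_C]
  exact evalHom_C _ _ _

theorem evalShift₂_uInv (a b : ℂ) :
    evalShift₂ A a b (uInv A) = scalarSeries A (shiftInv a) := by
  simp only [evalShift₂, uInv, RingHom.comp_apply, PowerSeries.map_X]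
  exact evalHom_X _ _

theorem evalShift₂_atV (a b : ℂ) (s : A⟦X⟧) : evalShift₂ A a b (atV s) = shift b s := by
  simp only [evalShift₂, atV, RingHom.comp_apply, PowerSeries.map_C, shiftHom_apply]
  exact evalHom_C _ _ _

theorem evalShift₂_vInv (a b : ℂ) :
    evalShift₂ A a b (vInv A) = scalarSeries A (shiftInv b) := by
  rw [← shiftHom_scalarSeries_X, shiftHom_apply]
  exact evalShift₂_atV a b _

theorem evalShift₂_atU (a b : ℂ) (s : A⟦X⟧) : evalShift₂ A a b (atU s) = shift a s := by
  rw [← shiftHom_apply, evalShift₂, RingHom.comp_apply]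
  change _ = evalShift A a (PowerSeries.map PowerSeries.C s)
  congr 1
  ext1 n
  rw [atU, PowerSeries.coeff_map, PowerSeries.coeff_map, shiftHom_C]

theorem evalShift₂_algebraMap (a b c : ℂ) :
    evalShift₂ A a b (algebraMap ℂ A⟦X⟧⟦X⟧ c) = algebraMap ℂ A⟦X⟧ c := by
  have h : algebraMap ℂ A⟦X⟧⟦X⟧ c = atV (PowerSeries.C (algebraMap ℂ A c)) := by
    rw [PowerSeries.algebraMap_apply, PowerSeries.algebraMap_apply, atV]
  rw [h, evalShift₂_atV, ← shiftHom_apply, shiftHom_C, PowerSeries.algebraMap_apply]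

theorem RTT.map {B : Type*} [Ring B] [Algebra ℂ B] (f : A →+* B)
    (hf : ∀ c, f (algebraMap ℂ A c) = algebraMap ℂ B c) {r₀ r₁ r₂ : A} {S U : Fin 3 → Fin 3 → A}
    (h : RTT r₀ r₁ r₂ S U) :
    RTT (f r₀) (f r₁) (f r₂) (fun i j => f (S i j)) (fun i j => f (U i j)) := by
  have h1 : (fun i j k l => f (rTens r₀ r₁ r₂ i j k l)) = rTens (f r₀) (f r₁) (f r₂) := by
    funext i j k l
    simp only [rTens, map_add, map_sub, map_mul, tensOne, tensP, tensQ, apply_ite f, map_one,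
      map_zero, map_pow, map_neg, hf]
  have h2 : (fun i j k l => f (tensFst S i j k l)) = tensFst (fun i j => f (S i j)) := by
    funext i j k l
    simp only [tensFst, apply_ite f, map_zero, map_mul, map_pow, map_neg, map_one]
  have h3 : (fun i j k l => f (tensSnd U i j k l)) = tensSnd (fun i j => f (U i j)) := by
    funext i j k l
    simp only [tensSnd, apply_ite f, map_zero, map_mul, map_pow, map_neg, map_one]
  have hm : ∀ a b : Tens A, (fun i j k l => f (tensMul a b i j k l)) =
      tensMul (fun i j k l => f (a i j k l)) (fun i j k l => f (b i j k l)) := by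
    intro a b
    funext i j k l
    exact map_tensMul f a b i j k l
  have key := congrArg (fun (a : Tens A) i j k l => f (a i j k l)) h
  simp only [hm] at key
  rwa [h1, h2, h3] at key

/-- Both sides of the relation are linear in `(r₀, r₁, r₂)`, so a common central regular factor
drops out. -/
theorem RTT.cancel {z r₀ r₁ r₂ : A} {S U : Fin 3 → Fin 3 → A} (hz : ∀ x, z * x = x * z)
    (hreg : ∀ x, z * x = 0 → x = 0) (h : RTT (z * r₀) (z * r₁) (z * r₂) S U) :
    RTT r₀ r₁ r₂ S U := by
  have h1 : rTens (z * r₀) (z * r₁) (z * r₂) = fun i j k l => z * rTens r₀ r₁ r₂ i j k l := by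
    funext i j k l
    simp only [rTens, mul_add, mul_sub, mul_assoc]
  unfold RTT at h ⊢
  rw [h1, tensMul_smul_right _ hz, tensMul_smul_left, tensMul_smul_left] at h
  funext i j k l
  rw [← sub_eq_zero]
  refine hreg _ ?_
  rw [mul_sub, sub_eq_zero]
  exact congrFun (congrFun (congrFun (congrFun h i) j) k) l

/-- The defining relation in two variables. -/
theorem RTT_two {T : Fin 3 → Fin 3 → A⟦X⟧} (hT : rttDefect T = 0) :
    RTT ((vInv A - uInv A) * (vInv A - uInv A - kappa • (uInv A * vInv A)))
      (uInv A * vInv A * (vInv A - uInv A - kappa • (uInv A * vInv A)))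
      (uInv A * vInv A * (vInv A - uInv A)) (fun i j => atU (T i j)) (fun i j => atV (T i j)) := by
  rw [rttDefect_eq_zero_iff] at hT
  exact hT

/-- The defining relation for the matrices `T(u + a)` and `T(u + b)`. -/
theorem RTT_shift {T : Fin 3 → Fin 3 → A⟦X⟧} (hT : rttDefect T = 0) (a b : ℂ) :
    RTT (algebraMap ℂ A⟦X⟧ ((a - b) * (a - b - kappa))) (algebraMap ℂ _ (a - b - kappa))
      (algebraMap ℂ _ (a - b)) (fun i j => shift a (T i j)) (fun i j => shift b (T i j)) := by
  have h := (RTT_two hT).map (evalShift₂ A a b) (evalShift₂_algebraMap a b)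
  simp only [map_mul, map_sub (evalShift₂ A a b), Algebra.smul_def, evalShift₂_uInv,
    evalShift₂_vInv, evalShift₂_algebraMap, evalShift₂_atU, evalShift₂_atV] at h
  simp only [← scalarSeries_C, ← map_mul, ← map_sub (scalarSeries A)] at h
  rw [shiftInv_sub] at h
  -- All three coefficients of the cleared `R`-matrix acquire the same factor `((u + a)⁻¹ (u +
  -- b)⁻¹)²`. It is written as four nested factors so that they can be cancelled one at a time.
  have h0 : PowerSeries.C (a - b) * (shiftInv a * shiftInv b) *
      (PowerSeries.C (a - b) * (shiftInv a * shiftInv b) -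
        PowerSeries.C kappa * (shiftInv a * shiftInv b)) =
      shiftInv a * (shiftInv b * (shiftInv a * (shiftInv b *
        PowerSeries.C ((a - b) * (a - b - kappa))))) := by
    simp only [map_sub, map_mul]; ring
  have h1 : shiftInv a * shiftInv b * (PowerSeries.C (a - b) * (shiftInv a * shiftInv b) -
        PowerSeries.C kappa * (shiftInv a * shiftInv b)) =
      shiftInv a * (shiftInv b * (shiftInv a * (shiftInv b *
        PowerSeries.C (a - b - kappa)))) := by
    simp only [map_sub]; ring
  have h2 : shiftInv a * shiftInv b * (PowerSeries.C (a - b) * (shiftInv a * shiftInv b)) =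
      shiftInv a * (shiftInv b * (shiftInv a * (shiftInv b * PowerSeries.C (a - b)))) := by
    ring
  rw [h0, h1, h2] at h
  simp only [map_mul (scalarSeries A) (shiftInv _)] at h
  have hc : ∀ (c : ℂ) {r₀ r₁ r₂ : A⟦X⟧} {S U : Fin 3 → Fin 3 → A⟦X⟧},
      RTT (scalarSeries A (shiftInv c) * r₀) (scalarSeries A (shiftInv c) * r₁)
        (scalarSeries A (shiftInv c) * r₂) S U → RTT r₀ r₁ r₂ S U := fun c _ _ _ _ _ h =>
    h.cancel (scalarSeries_comm _) (fun _ => scalar_shiftInv_regular)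
  simp only [← scalarSeries_C]
  exact hc b (hc a (hc b (hc a h)))

end Specialisation

/-! ### The matrix entries of the relation that are needed. -/

section Components

variable {B : Type*} [Ring B] [Algebra ℂ B] {r₀ r₁ r₂ : B} {S U : Fin 3 → Fin 3 → B}

theorem RTT.entry (h : RTT r₀ r₁ r₂ S U) (i j k l : Fin 3) :
    tensMul (tensMul (rTens r₀ r₁ r₂) (tensFst S)) (tensSnd U) i j k l =
      tensMul (tensMul (tensSnd U) (tensFst S)) (rTens r₀ r₁ r₂) i j k l :=
  congrFun (congrFun (congrFun (congrFun h i) j) k) l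

/-- Here and below `entry_ij_kl` is the coefficient of `e_ij ⊗ e_kl`, with indices counted from `1`
and `3` standing for `1'`. The term `Q` contributes to the left side only when `k = i'` and to the
right side only when `l = j'`. -/
theorem RTT.entry_11_11 (h : RTT r₀ r₁ r₂ S U) :
    (r₀ + r₁) * S 0 0 * U 0 0 = U 0 0 * S 0 0 * (r₀ + r₁) := by
  have := h.entry 0 0 0 0
  simp [tensMul, tensFst, tensSnd, rTens, tensOne, tensP, tensQ, Fin.sum_univ_three, par] at this
  simpa [Even.neg_one_pow (show Even 12 by decide)] using this

theorem RTT.entry_11_21 (h : RTT r₀ r₁ r₂ S U) :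
    r₀ * S 0 0 * U 1 0 + r₁ * S 1 0 * U 0 0 = U 1 0 * S 0 0 * (r₀ + r₁) := by
  have := h.entry 0 0 1 0
  simp [tensMul, tensFst, tensSnd, rTens, tensOne, tensP, tensQ, Fin.sum_univ_three, par] at this
  norm_num at this
  rw [← neg_inj, ← this]
  abel

theorem RTT.entry_11_12 (h : RTT r₀ r₁ r₂ S U) :
    (r₀ + r₁) * S 0 0 * U 0 1 = U 0 1 * S 0 0 * r₀ + U 0 0 * S 0 1 * r₁ := by
  have := h.entry 0 0 0 1
  simp [tensMul, tensFst, tensSnd, rTens, tensOne, tensP, tensQ, Fin.sum_univ_three, par] at this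
  norm_num at this
  exact this

theorem RTT.entry_11_22 (h : RTT r₀ r₁ r₂ S U) :
    r₀ * S 0 0 * U 1 1 + r₁ * S 1 0 * U 0 1 = U 1 1 * S 0 0 * r₀ + U 1 0 * S 0 1 * r₁ := by
  have := h.entry 0 0 1 1
  simp [tensMul, tensFst, tensSnd, rTens, tensOne, tensP, tensQ, Fin.sum_univ_three, par] at this
  norm_num at this
  rw [← this]
  abel

theorem RTT.entry_11_31 (h : RTT r₀ r₁ r₂ S U) :
    (r₁ + r₂) * S 2 0 * U 0 0 + r₂ * S 1 0 * U 1 0 + (r₀ - r₂) * S 0 0 * U 2 0 =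
      U 2 0 * S 0 0 * (r₀ + r₁) := by
  have := h.entry 0 0 2 0
  simp [tensMul, tensFst, tensSnd, rTens, tensOne, tensP, tensQ, Fin.sum_univ_three, par,
    theta] at this
  norm_num at this
  rw [← this, sub_eq_add_neg]

theorem RTT.entry_11_32 (h : RTT r₀ r₁ r₂ S U) :
    (r₁ + r₂) * S 2 0 * U 0 1 + r₂ * S 1 0 * U 1 1 + (r₀ - r₂) * S 0 0 * U 2 1 =
      U 2 1 * S 0 0 * r₀ + U 2 0 * S 0 1 * r₁ := by
  have := h.entry 0 0 2 1
  simp [tensMul, tensFst, tensSnd, rTens, tensOne, tensP, tensQ, Fin.sum_univ_three, par,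
    theta] at this
  norm_num at this
  rw [← this, sub_eq_add_neg]

theorem RTT.entry_11_13 (h : RTT r₀ r₁ r₂ S U) :
    (r₀ + r₁) * S 0 0 * U 0 2 =
      U 0 2 * S 0 0 * (r₀ - r₂) - U 0 1 * S 0 1 * r₂ + U 0 0 * S 0 2 * (r₁ + r₂) := by
  have := h.entry 0 0 0 2
  simp [tensMul, tensFst, tensSnd, rTens, tensOne, tensP, tensQ, Fin.sum_univ_three, par,
    theta] at this
  norm_num at this
  rw [this, sub_eq_add_neg, sub_eq_add_neg]

theorem RTT.entry_13_21 (h : RTT r₀ r₁ r₂ S U) :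
    r₀ * S 0 2 * U 1 0 + r₁ * S 1 2 * U 0 0 =
      U 1 2 * S 0 0 * (r₁ + r₂) + U 1 1 * S 0 1 * r₂ + U 1 0 * S 0 2 * (r₀ - r₂) := by
  have := h.entry 0 2 1 0
  simp [tensMul, tensFst, tensSnd, rTens, tensOne, tensP, tensQ, Fin.sum_univ_three, par,
    theta] at this
  norm_num at this
  rw [← neg_inj, sub_eq_add_neg r₀ r₂, neg_add, add_comm, this]
  abel

end Components

/-! ### Commutation of `h₁(u)` with `h₂(v)`. -/

section Commutation

variable {B : Type*} [Ring B]

/-- Unprimed letters are entries at `u`, primed ones at `v`. By `e₄`, `r₀[h, d'] = r₁(c'b - cb')`.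
Moving `h` through `c' hi' b'` from either end with `e₂` and `e₃` yields the same leading term `(r₀
+ r₁) c' h hi' b'`, and the leftover terms give `r₀[h, c' hi' b'] = r₁(c'b - cb')` as well. The two
commutators cancel, and `r₀` is regular. -/
theorem quasidet_comm {r₀ r₁ h h' hi' b b' c c' d' : B}
    (hr₀ : ∀ x, r₀ * x = x * r₀) (hr₁ : ∀ x, r₁ * x = x * r₁)
    (hreg : ∀ x, r₀ * x = 0 → x = 0) (hreg' : ∀ x, (r₀ + r₁) * x = 0 → x = 0)
    (hh' : h' * hi' = 1) (ih' : hi' * h' = 1)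
    (e₁ : (r₀ + r₁) * h * h' = h' * h * (r₀ + r₁))
    (e₂ : r₀ * h * c' + r₁ * c * h' = c' * h * (r₀ + r₁))
    (e₃ : (r₀ + r₁) * h * b' = b' * h * r₀ + h' * b * r₁)
    (e₄ : r₀ * h * d' + r₁ * c * b' = d' * h * r₀ + c' * b * r₁) :
    h * (d' - c' * hi' * b') = (d' - c' * hi' * b') * h := by
  have hr : ∀ x, (r₀ + r₁) * x = x * (r₀ + r₁) := fun x => by rw [add_mul, mul_add, hr₀, hr₁]
  have hcomm : h * h' = h' * h := by
    rw [← sub_eq_zero]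
    refine hreg' _ ?_
    rw [mul_sub, ← mul_assoc, e₁, hr, sub_self]
  have hcomm' : h * hi' = hi' * h := by
    calc h * hi' = hi' * (h' * h) * hi' := by rw [← mul_assoc, ih', one_mul]
      _ = hi' * h := by rw [← hcomm, mul_assoc, mul_assoc, hh', mul_one]
  rw [← sub_eq_zero]
  refine hreg _ ?_
  have f₂ : r₀ * (h * c' * hi') = (r₀ + r₁) * (c' * hi' * h) - r₁ * c := by
    have := congrArg (· * hi') e₂
    simp only [add_mul _ _ hi'] at this
    rw [mul_assoc (r₁ * c), hh', mul_one, ← hr] at this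
    rw [mul_assoc c', ← hcomm', ← mul_assoc c', eq_sub_iff_add_eq]
    simpa only [mul_assoc] using this
  have f₃ : r₀ * (hi' * b' * h) = (r₀ + r₁) * (h * hi' * b') - r₁ * b := by
    have := congrArg (hi' * ·) e₃
    have hx : hi' * ((r₀ + r₁) * h * b') = (r₀ + r₁) * (hi' * (h * b')) := by
      rw [mul_assoc, ← mul_assoc hi', ← hr, mul_assoc]
    simp only [mul_add hi', hx] at this
    rw [eq_sub_iff_add_eq, hr₀, hr₁ b, hcomm']
    rw [mul_assoc h' b r₁, ← mul_assoc hi' h', ih', one_mul] at this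
    simpa only [mul_assoc] using this.symm
  have f₄ : r₀ * (h * d' - d' * h) = r₁ * (c' * b - c * b') := by
    rw [mul_sub, mul_sub, sub_eq_sub_iff_add_eq_add, hr₀ (d' * h), hr₁ (c' * b), ← mul_assoc,
      ← mul_assoc, e₄, add_comm]
  have g₁ : r₀ * (h * (c' * hi' * b')) = r₀ * (h * c' * hi') * b' := by simp only [mul_assoc]
  have g₂ : r₀ * (c' * hi' * b' * h) = c' * (r₀ * (hi' * b' * h)) := by
    rw [← mul_assoc c' r₀, ← hr₀ c']; simp only [mul_assoc]
  have : h * (d' - c' * hi' * b') - (d' - c' * hi' * b') * h =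
      (h * d' - d' * h) - h * (c' * hi' * b') + c' * hi' * b' * h := by
    rw [mul_sub, sub_mul]; abel
  rw [this, mul_add, mul_sub, f₄, g₁, g₂, f₂, f₃, mul_sub c', ← mul_assoc c' (r₀ + r₁), ← hr c',
    ← mul_assoc c' r₁, ← hr₁ c', sub_mul, mul_sub r₁, hcomm', mul_assoc c' hi' h, hcomm'.symm]
  simp only [mul_assoc]
  abel

end Commutation

/-! ### Regularity of the denominators, and passing from two variables to one. -/

section Regular

variable {A : Type*} [Ring A]

/-- In degree `m` in `u⁻¹` the equation expresses `v⁻¹ F_m` through the `F_j` with `j < m`, so all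
coefficients vanish by induction. -/
theorem vInv_sub_uInv_mul_regular (G F : A⟦X⟧⟦X⟧) (h : (vInv A - uInv A * G) * F = 0) : F = 0 := by
  have hz : ∀ m, PowerSeries.coeff m F = 0 := by
    intro m
    induction m using Nat.strong_induction_on with
    | _ m ih =>
      have h1 := congrArg (PowerSeries.coeff m) h
      rw [sub_mul, mul_assoc, map_sub, map_zero, vInv, uInv, PowerSeries.coeff_C_mul] at h1
      have h2 : PowerSeries.coeff m (PowerSeries.X * (G * F)) = 0 := by
        cases m with
        | zero => rw [PowerSeries.coeff_zero_X_mul]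
        | succ m =>
          rw [PowerSeries.coeff_succ_X_mul, PowerSeries.coeff_mul]
          refine Finset.sum_eq_zero fun x hx => ?_
          rw [Finset.HasAntidiagonal.mem_antidiagonal] at hx
          rw [ih x.2 (by omega), mul_zero]
      rw [h2, sub_zero] at h1
      ext n
      have := congrArg (PowerSeries.coeff (n + 1)) h1
      rwa [PowerSeries.coeff_succ_X_mul] at this
  ext1 m
  rw [hz m, map_zero]

theorem uInv_comm (x : A⟦X⟧⟦X⟧) : uInv A * x = x * uInv A := PowerSeries.X_mul

theorem vInv_comm [Algebra ℂ A] (x : A⟦X⟧⟦X⟧) : vInv A * x = x * vInv A := by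
  have h : vInv A = atV (scalarSeries A PowerSeries.X) := by
    rw [scalarSeries, PowerSeries.map_X]; rfl
  rw [h, atV_scalar_comm]

/-- With independent variables the hypothesis says that each coefficient of `a` commutes with each
coefficient of `b`. -/
theorem mul_comm_of_atU_comm_atV {a b : A⟦X⟧} (h : atU a * atV b = atV b * atU a) : a * b = b * a := by
  ext n
  rw [PowerSeries.coeff_mul, PowerSeries.coeff_mul, ← Finset.Nat.sum_antidiagonal_swap]
  refine Finset.sum_congr rfl fun p _ => ?_
  have := congrArg (fun s => PowerSeries.coeff p.1 (PowerSeries.coeff p.2 s)) h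
  simp only [coeff_atU_mul_atV, coeff_atV_mul_atU] at this
  exact this

end Regular

/-- The series `t_{11}(u)` commutes with `t₂₂(u) - t₂₁(u) t₁₁(u)⁻¹ t₁₂(u)`. -/
theorem h₁X_comm_h₂X : h₁X * h₂X = h₂X * h₁X := by
  -- Two variables are essential: at `u = v` the coefficient `r₀` vanishes and could not be
  -- cancelled.
  apply mul_comm_of_atU_comm_atV
  have hR := RTT_two rttDefect_tSeries
  set x := uInv ExtYangian with hx
  set y := vInv ExtYangian with hy
  have hxc : ∀ z, x * z = z * x := uInv_comm
  have hyc : ∀ z, y * z = z * y := vInv_comm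
  have hxy : ∀ z, x * y * z = z * (x * y) := fun z => by
    rw [mul_assoc, hyc, ← mul_assoc, hxc, mul_assoc]
  have hd : ∀ z, (y - x) * z = z * (y - x) := fun z => by rw [sub_mul, mul_sub, hxc, hyc]
  have hk : ∀ z, (y - x - kappa • (x * y)) * z = z * (y - x - kappa • (x * y)) := fun z => by
    rw [sub_mul, mul_sub, hd, smul_mul_assoc, mul_smul_comm, hxy]
  have reg₁ : ∀ z, (y - x) * z = 0 → z = 0 := fun z hz =>
    -- The three regular elements are the factors of `r₀ = (y - x)(y - x - κxy)` and of `r₀ + r₁`,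
    -- which is `y - x + xy` times `y - x - κxy`. Each has the form `y - xG`.
    vInv_sub_uInv_mul_regular 1 z (by rw [mul_one]; exact hz)
  have reg₂ : ∀ z, (y - x - kappa • (x * y)) * z = 0 → z = 0 := fun z hz =>
    vInv_sub_uInv_mul_regular (1 + kappa • y) z (by
      rw [mul_add, mul_one, mul_smul_comm, ← sub_sub]; exact hz)
  have reg₃ : ∀ z, (y - x + x * y) * z = 0 → z = 0 := fun z hz =>
    vInv_sub_uInv_mul_regular (1 - y) z (by
      rw [mul_sub, mul_one, sub_sub_eq_add_sub, add_sub_right_comm]; exact hz)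
  have hmul : ∀ a b : ExtYangian⟦X⟧⟦X⟧, (∀ z, a * z = z * a) → (∀ z, b * z = z * b) →
      ∀ z, a * b * z = z * (a * b) := fun a b ha hb z => by
    rw [mul_assoc, hb, ← mul_assoc, ha, mul_assoc]
  have hinv : atV (tSeries 0 0) * atV (invSeries (tSeries 0 0)) = 1 := by
    rw [← map_mul, mul_invSeries (tSeries 0 0) constantCoeff_h₁X, map_one]
  have hinv' : atV (invSeries (tSeries 0 0)) * atV (tSeries 0 0) = 1 := by
    rw [← map_mul, invSeries_mul (tSeries 0 0) constantCoeff_h₁X, map_one]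
  have := quasidet_comm (hmul _ _ hd hk) (hmul _ _ hxy hk)
    (fun z hz => reg₂ z (reg₁ _ (by rw [← mul_assoc]; exact hz)))
    (fun z hz => reg₂ z (reg₃ _ (by rw [← mul_assoc, add_mul]; exact hz)))
    hinv hinv' hR.entry_11_11 hR.entry_11_21 hR.entry_11_12 hR.entry_11_22
  rw [h₁X, h₂X, map_sub, map_mul, map_mul]
  exact this

/-! ### The relation at `u - v = -1`, `κ` and `1/2`. -/

section Relations

/-- The defining relation at `u - v = -1`. -/
theorem RTT_shift_one : RTT (algebraMap ℂ _ (-1 / 2)) (algebraMap ℂ _ (1 / 2))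
    (algebraMap ℂ _ (-1)) tSeries (fun i j => shift 1 (tSeries i j)) := by
  have h := RTT_shift rttDefect_tSeries 0 1
  simp only [shift_zero] at h
  convert h using 2 <;> norm_num [kappa]

/-- The defining relation at `u - v = κ`. -/
theorem RTT_shift_kappa : RTT (algebraMap ℂ _ 0) (algebraMap ℂ _ 0)
    (algebraMap ℂ _ (-3 / 2)) (fun i j => shift (-3 / 2) (tSeries i j)) tSeries := by
  have h := RTT_shift rttDefect_tSeries (-3 / 2) 0
  simp only [shift_zero] at h
  convert h using 2 <;> norm_num [kappa]

/-- The defining relation at `u - v = 1 / 2`. -/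
theorem RTT_shift_half : RTT (algebraMap ℂ _ 1) (algebraMap ℂ _ 2)
    (algebraMap ℂ _ (1 / 2)) tSeries (fun i j => shift (-1 / 2) (tSeries i j)) := by
  have h := RTT_shift rttDefect_tSeries 0 (-1 / 2)
  simp only [shift_zero] at h
  convert h using 2 <;> norm_num [kappa]

/-- The defining relation at `u - v = -1`, after a shift of both variables. -/
theorem RTT_shift_kappa_half : RTT (algebraMap ℂ _ (-1 / 2)) (algebraMap ℂ _ (1 / 2))
    (algebraMap ℂ _ (-1)) (fun i j => shift (-3 / 2) (tSeries i j))
    (fun i j => shift (-1 / 2) (tSeries i j)) := by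
  have h := RTT_shift rttDefect_tSeries (-3 / 2) (-1 / 2)
  convert h using 2 <;> norm_num [kappa]

theorem shift_h_mul_inv (c : ℂ) :
    shift c (tSeries 0 0) * shift c (invSeries (tSeries 0 0)) = 1 := by
  rw [← shift_mul, mul_invSeries (tSeries 0 0) constantCoeff_h₁X, shift_one]

theorem shift_inv_mul_h (c : ℂ) :
    shift c (invSeries (tSeries 0 0)) * shift c (tSeries 0 0) = 1 := by
  rw [← shift_mul, invSeries_mul (tSeries 0 0) constantCoeff_h₁X, shift_one]

theorem shift_fX_mul (c : ℂ) (j : Fin 3) :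
    shift c (fX j) * shift c (tSeries 0 0) = shift c (tSeries j 0) := by
  rw [fX, h₁X, shift_mul, mul_assoc, shift_inv_mul_h, mul_one]

theorem shift_mul_eX (c : ℂ) (j : Fin 3) :
    shift c (tSeries 0 0) * shift c (eX j) = shift c (tSeries 0 j) := by
  rw [eX, h₁X, shift_mul, ← mul_assoc, shift_h_mul_inv, one_mul]

theorem algebraMap_mul_cancel {A : Type*} [Ring A] [Algebra ℂ A] {c : ℂ} (hc : c ≠ 0) {x y : A}
    (h : algebraMap ℂ A c * x = algebraMap ℂ A c * y) : x = y := by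
  have := congrArg (algebraMap ℂ A c⁻¹ * ·) h
  simpa only [← mul_assoc, ← map_mul, inv_mul_cancel₀ hc, map_one, one_mul] using this

/-- At `u - v = -1` one has `r₀ + r₁ = 0`, so the right side of the entry vanishes and the two left
terms have opposite coefficients. `Q` does not enter, hence the arbitrary `r₂`. -/
theorem RTT.minus_one_21 {A : Type*} [Ring A] [Algebra ℂ A] {S U : Fin 3 → Fin 3 → A} {r₂ : A}
    (h : RTT (algebraMap ℂ _ (-1 / 2)) (algebraMap ℂ _ (1 / 2)) r₂ S U) :
    S 0 0 * U 1 0 = S 1 0 * U 0 0 := by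
  have h1 := h.entry_11_21
  have h2 : algebraMap ℂ A (-1 / 2) + algebraMap ℂ A (1 / 2) = 0 := by
    rw [← map_add]; norm_num
  have h3 : algebraMap ℂ A (-1 / 2) = - algebraMap ℂ A (1 / 2) := eq_neg_of_add_eq_zero_left h2
  rw [h2, mul_zero, h3, mul_assoc, mul_assoc, neg_mul, neg_add_eq_zero] at h1
  exact algebraMap_mul_cancel (by norm_num) h1

theorem RTT.minus_one_12 {A : Type*} [Ring A] [Algebra ℂ A] {S U : Fin 3 → Fin 3 → A} {r₂ : A}
    (h : RTT (algebraMap ℂ _ (-1 / 2)) (algebraMap ℂ _ (1 / 2)) r₂ S U) :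
    U 0 1 * S 0 0 = U 0 0 * S 0 1 := by
  have h1 := h.entry_11_12
  have h2 : algebraMap ℂ A (-1 / 2) + algebraMap ℂ A (1 / 2) = 0 := by
    rw [← map_add]; norm_num
  have h3 : algebraMap ℂ A (-1 / 2) = - algebraMap ℂ A (1 / 2) := eq_neg_of_add_eq_zero_left h2
  rw [h2, zero_mul, zero_mul, h3, mul_neg, eq_comm, neg_add_eq_zero, ← Algebra.commutes,
    ← Algebra.commutes] at h1
  exact algebraMap_mul_cancel (by norm_num) h1

/-- Again `r₀ + r₁ = 0` removes the right side, but now `Q` contributes. Its middle term, with `r₂ =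
-1` against `r₁ + r₂ = -1/2`, is the source of the quadratic correction `-2f(u + 1)²`. -/
theorem RTT.minus_one_31 {A : Type*} [Ring A] [Algebra ℂ A] {S U : Fin 3 → Fin 3 → A}
    (h : RTT (algebraMap ℂ _ (-1 / 2)) (algebraMap ℂ _ (1 / 2)) (algebraMap ℂ _ (-1)) S U) :
    S 2 0 * U 0 0 = S 0 0 * U 2 0 - 2 * (S 1 0 * U 1 0) := by
  have h1 := h.entry_11_31
  simp only [← map_add, ← map_sub, ← Algebra.commutes (R := ℂ), ← Algebra.smul_def,
    smul_mul_assoc] at h1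
  rw [two_mul, ← two_smul ℂ]
  linear_combination (norm := module) (-2 : ℂ) • h1

theorem RTT.minus_one_13 {A : Type*} [Ring A] [Algebra ℂ A] {S U : Fin 3 → Fin 3 → A}
    (h : RTT (algebraMap ℂ _ (-1 / 2)) (algebraMap ℂ _ (1 / 2)) (algebraMap ℂ _ (-1)) S U) :
    U 0 2 * S 0 0 = U 0 0 * S 0 2 - 2 * (U 0 1 * S 0 1) := by
  have h1 := h.entry_11_13
  simp only [← map_add, ← map_sub, ← Algebra.commutes (R := ℂ), ← Algebra.smul_def,
    smul_mul_assoc] at h1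
  rw [two_mul, ← two_smul ℂ]
  linear_combination (norm := module) (-2 : ℂ) • h1

end Relations

/-! ### Moving `h₁(u)` past shifted Gaussian series, and the two quasideterminants. -/

section GaussRelations

theorem h₁X_mul_inv : h₁X * invSeries h₁X = 1 := mul_invSeries _ constantCoeff_h₁X

theorem inv_mul_h₁X : invSeries h₁X * h₁X = 1 := invSeries_mul _ constantCoeff_h₁X

theorem h₁X_mul_eX (j : Fin 3) : h₁X * eX j = tSeries 0 j := by
  rw [eX, ← mul_assoc, h₁X_mul_inv, one_mul]

theorem fX_mul_h₁X (j : Fin 3) : fX j * h₁X = tSeries j 0 := by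
  rw [fX, mul_assoc, inv_mul_h₁X, mul_one]

theorem right_cancel_shift_h {c : ℂ} {a b : ExtYangian⟦X⟧}
    (h : a * shift c (tSeries 0 0) = b * shift c (tSeries 0 0)) : a = b := by
  have := congrArg (· * shift c (invSeries (tSeries 0 0))) h
  simpa only [mul_assoc, shift_h_mul_inv, mul_one] using this

theorem left_cancel_shift_h {c : ℂ} {a b : ExtYangian⟦X⟧}
    (h : shift c (tSeries 0 0) * a = shift c (tSeries 0 0) * b) : a = b := by
  have := congrArg (shift c (invSeries (tSeries 0 0)) * ·) h
  simpa only [← mul_assoc, shift_inv_mul_h, one_mul] using this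

/-- `h₁(u) f(u + 1) = t₂₁(u)`. -/
theorem h₁X_mul_shift_f : h₁X * shift 1 (fX 1) = tSeries 1 0 := by
  refine right_cancel_shift_h (c := 1) ?_
  rw [mul_assoc, shift_fX_mul]
  exact RTT_shift_one.minus_one_21

/-- `e(u + 1) h₁(u) = t₁₂(u)`. -/
theorem shift_e_mul_h₁X : shift 1 (eX 1) * h₁X = tSeries 0 1 := by
  refine left_cancel_shift_h (c := 1) ?_
  rw [← mul_assoc, shift_mul_eX]
  exact RTT_shift_one.minus_one_12

theorem h₁X_mul_shift_f₁₁ :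
    h₁X * (shift 1 (fX 2) - 2 * shift 1 (fX 1) ^ 2) = tSeries 2 0 := by
  refine right_cancel_shift_h (c := 1) ?_
  rw [RTT_shift_one.minus_one_31, ← shift_fX_mul 1 1, ← shift_fX_mul 1 2, ← h₁X_mul_shift_f]
  -- The first `tSeries 0 0` is folded back to `h₁X`, so that both sides are polynomials in the same
  -- letters.
  change _ = h₁X * _ - _
  noncomm_ring

theorem shift_e₁₁_mul_h₁X :
    (shift 1 (eX 2) + 2 * shift 1 (eX 1) ^ 2) * h₁X = tSeries 0 2 := by
  refine left_cancel_shift_h (c := 1) ?_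
  have h := RTT_shift_one.minus_one_13
  rw [← shift_mul_eX 1 1, ← shift_mul_eX 1 2, ← shift_e_mul_h₁X] at h
  change _ * h₁X = _ at h
  rw [← sub_eq_zero] at h ⊢
  rw [← h]
  noncomm_ring

/-- The `11-21` entry at `v = u - 1/2`, where `(r₀, r₁) = (1, 2)`, reads `h₁(u) t₂₁(v) + 2 t₂₁(u)
h₁(v) = 3 t₂₁(v) h₁(u)`. Substituting `t₂₁(u) = h₁(u) f(u + 1)` and `t₂₁(v) = f(v) h₁(v)`, one
cancels `h₁(v)`. The weights are `r₀/(r₀ + r₁)` and `r₁/(r₀ + r₁)`. -/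
theorem h₁X_mul_half_f :
    h₁X * ((1 / 3 : ℂ) • shift (-1 / 2) (fX 1) + (2 / 3 : ℂ) • shift 1 (fX 1)) =
      shift (-1 / 2) (fX 1) * h₁X := by
  refine right_cancel_shift_h (c := -1 / 2) ?_
  have h₁ := RTT_shift_half.entry_11_21
  have h₂ := RTT_shift_half.entry_11_11
  have hs := shift_fX_mul (-1 / 2) 1
  simp only [← map_add, ← Algebra.commutes (R := ℂ), ← Algebra.smul_def, smul_mul_assoc] at h₁ h₂
  rw [← hs, ← h₁X_mul_shift_f] at h₁
  change _ • (h₁X * _) = _ • (_ * h₁X) at h₂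
  change _ • (h₁X * _) + _ = _ • (_ * h₁X) at h₁
  -- The two values of `h₁` commute because `r₀ + r₁ = 3` is invertible.
  have h₃ : h₁X * shift (-1 / 2) (tSeries 0 0) = shift (-1 / 2) (tSeries 0 0) * h₁X := by
    linear_combination (norm := module) (1 / 3 : ℂ) • h₂
  rw [mul_assoc _ _ h₁X, ← h₃] at h₁
  simp only [mul_add, add_mul, mul_smul_comm, smul_mul_assoc, mul_assoc] at h₁ ⊢
  linear_combination (norm := module) (1 / 3 : ℂ) • h₁

theorem half_e_mul_h₁X :
    ((1 / 3 : ℂ) • shift (-1 / 2) (eX 1) + (2 / 3 : ℂ) • shift 1 (eX 1)) * h₁X =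
      h₁X * shift (-1 / 2) (eX 1) := by
  refine left_cancel_shift_h (c := -1 / 2) ?_
  have h₁ := RTT_shift_half.entry_11_12
  have h₂ := RTT_shift_half.entry_11_11
  have hs := shift_mul_eX (-1 / 2) 1
  simp only [← map_add, ← Algebra.commutes (R := ℂ), ← Algebra.smul_def, smul_mul_assoc] at h₁ h₂
  rw [← hs, ← shift_e_mul_h₁X] at h₁
  change _ • (h₁X * _) = _ • (_ * h₁X) at h₂
  change _ • (h₁X * _) = _ • (_ * h₁X) + _ at h₁
  have h₃ : h₁X * shift (-1 / 2) (tSeries 0 0) = shift (-1 / 2) (tSeries 0 0) * h₁X := by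
    linear_combination (norm := module) (1 / 3 : ℂ) • h₂
  rw [← mul_assoc h₁X, h₃] at h₁
  simp only [mul_add, add_mul, mul_smul_comm, smul_mul_assoc, mul_assoc] at h₁ ⊢
  linear_combination (norm := module) (-1 / 3 : ℂ) • h₁

/-- The quasideterminant `t_{1'2} - t_{1'1} t₁₁⁻¹ t₁₂` equals `f(u - 1/2) h₂(u)`. -/
theorem lower_quasidet :
    tSeries 2 1 - tSeries 2 0 * eX 1 = shift (-1 / 2) (fX 1) * h₂X := by
  -- This is `h₁(u) f(u + 1) = t₂₁(u)` with `u` replaced by `u - 3/2`.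
  have hf : shift (-3 / 2) (tSeries 0 0) * shift (-1 / 2) (fX 1) =
      shift (-3 / 2) (tSeries 1 0) := by
    refine right_cancel_shift_h (c := -1 / 2) ?_
    rw [mul_assoc, shift_fX_mul]
    exact RTT_shift_kappa_half.minus_one_21
  -- Only `Q` survives at `u - v = κ`. With `S = T(u - 3/2)`, the two entries express `S₁₁ t₁'₁` and
  -- `S₁₁ t₁'₂` through the same row `S₁'₁, S₂₁`. In `S₁₁(t₁'₂ - t₁'₁ e)` the coefficient of `S₁'₁`
  -- is `t₁₂ - t₁₁ e = 0`, and that of `S₂₁` is `h₂`.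
  have h₁ := RTT_shift_kappa.entry_11_31
  have h₂ := RTT_shift_kappa.entry_11_32
  simp only [map_zero, zero_add, zero_sub, mul_zero, neg_mul, mul_assoc] at h₁ h₂
  rw [← mul_add, ← sub_eq_add_neg, sub_eq_zero] at h₁ h₂
  replace h₁ := algebraMap_mul_cancel (by norm_num) h₁
  replace h₂ := algebraMap_mul_cancel (by norm_num) h₂
  have h₃ : tSeries 0 0 * eX 1 = tSeries 0 1 := h₁X_mul_eX 1
  refine left_cancel_shift_h (c := -3 / 2) ?_
  rw [← mul_assoc, hf, mul_sub, ← mul_assoc, ← h₁, ← h₂, add_mul,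
    mul_assoc _ (tSeries 0 0), h₃, h₂X, eX, h₁X]
  simp only [mul_sub, mul_assoc]
  abel

/-- The quasideterminant `t_{21'} - t₂₁ t₁₁⁻¹ t_{11'}` equals `-h₂(u) e(u - 1/2)`. -/
theorem upper_quasidet :
    tSeries 1 2 - fX 1 * tSeries 0 2 = - (h₂X * shift (-1 / 2) (eX 1)) := by
  have he : shift (-1 / 2) (eX 1) * shift (-3 / 2) (tSeries 0 0) =
      shift (-3 / 2) (tSeries 0 1) := by
    refine left_cancel_shift_h (c := -1 / 2) ?_
    rw [← mul_assoc, shift_mul_eX]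
    exact RTT_shift_kappa_half.minus_one_12
  -- The mirror elimination: these entries express `t₁₁' S₁₁` and `t₂₁' S₁₁` through `S₁₁'` and
  -- `S₁₂`. The coefficient of `S₁₁'` in the combination is `t₂₁ - f t₁₁ = 0`, and the minus sign
  -- comes from that of `S₁₂`.
  have h₁ := RTT_shift_kappa.entry_11_13
  have h₂ := RTT_shift_kappa.entry_13_21
  simp only [map_zero, zero_add, zero_sub, zero_mul, mul_neg, ← Algebra.commutes (R := ℂ)] at h₁ h₂
  replace h₁ : tSeries 0 2 * shift (-3 / 2) (tSeries 0 0) =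
      tSeries 0 0 * shift (-3 / 2) (tSeries 0 2) - tSeries 0 1 * shift (-3 / 2) (tSeries 0 1) := by
    refine algebraMap_mul_cancel (c := -3 / 2) (by norm_num) ?_
    rw [mul_sub, ← sub_eq_zero, ← neg_eq_zero, eq_comm, h₁]
    abel
  replace h₂ : tSeries 1 2 * shift (-3 / 2) (tSeries 0 0) =
      tSeries 1 0 * shift (-3 / 2) (tSeries 0 2) - tSeries 1 1 * shift (-3 / 2) (tSeries 0 1) := by
    refine algebraMap_mul_cancel (c := -3 / 2) (by norm_num) ?_
    rw [mul_sub, ← sub_eq_zero, eq_comm, h₂]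
    abel
  refine right_cancel_shift_h (c := -3 / 2) ?_
  have h₃ : fX 1 * (tSeries 0 0 * shift (-3 / 2) (tSeries 0 2)) =
      tSeries 1 0 * shift (-3 / 2) (tSeries 0 2) := by
    rw [← mul_assoc, ← fX_mul_h₁X 1]; rfl
  rw [neg_mul, mul_assoc h₂X, he, sub_mul, mul_assoc (fX 1), h₁, h₂, mul_sub, h₃, h₂X, fX, h₁X]
  simp only [sub_mul, mul_assoc]
  abel

theorem h₁X_mul_kX : h₁X * kX = h₂X := by
  rw [kX, ← mul_assoc, h₁X_mul_inv, one_mul]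

/-- Here `h₁⁻¹` stands on the wrong side in the definition of `k`, so the commutation of `h₁` and
`h₂` is needed. -/
theorem kX_mul_h₁X : kX * h₁X = h₂X := by
  rw [kX, mul_assoc, ← h₁X_comm_h₂X, ← mul_assoc, inv_mul_h₁X, one_mul]

end GaussRelations

/-! ### Convergence of the geometric series. -/

section FormalSum

variable {A : Type*} [Ring A]

/-- The `M`-th partial sum differs from `(1 + W)⁻¹` by `(1 + W)⁻¹ (-W)^M`, which has no terms of
degree less than `M`. -/
theorem hasFormalSum_geometric {W : A⟦X⟧} (hW : PowerSeries.constantCoeff W = 0) :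
    HasFormalSum (fun r => (-1) ^ r * W ^ r) (invSeries (1 + W)) := by
  have h1 : PowerSeries.constantCoeff (1 + W) = 1 := by rw [map_add, map_one, hW, add_zero]
  intro n
  refine ⟨n + 1, fun M hM => ?_⟩
  have h2 : ∑ r ∈ Finset.range M, (-1) ^ r * W ^ r =
      invSeries (1 + W) - invSeries (1 + W) * (-W) ^ M := by
    have h3 := mul_neg_geom_sum (-W) M
    simp only [neg_pow W] at h3
    rw [sub_neg_eq_add] at h3
    have h4 := congrArg (invSeries (1 + W) * ·) h3
    simp only [← mul_assoc] at h4
    rw [invSeries_mul _ h1, one_mul, mul_sub, mul_one] at h4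
    rw [h4, neg_pow W]
  rw [h2, map_sub, coeff_mul_pow_of_lt (by rw [map_neg, hW, neg_zero]) _ (by omega), sub_zero]

end FormalSum

/-! ### The two tensor factors inside `X ⊗ X` and their commutation. -/

section Transfer

variable {A B : Type*} [Ring A] [Ring B] [Algebra ℂ A] [Algebra ℂ B]

theorem map_smul_series (f : A →ₐ[ℂ] B) (c : ℂ) (a : A⟦X⟧) :
    PowerSeries.map (f : A →+* B) (c • a) = c • PowerSeries.map (f : A →+* B) a := by
  ext n
  simp

theorem map_shift (f : A →ₐ[ℂ] B) (c : ℂ) (a : A⟦X⟧) :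
    PowerSeries.map (f : A →+* B) (shift c a) = shift c (PowerSeries.map (f : A →+* B) a) := by
  ext n
  simp [shift]

/-- The embedding of series over the Yangian into those over the extended Yangian. -/
def valY : Yangian⟦X⟧ →+* ExtYangian⟦X⟧ := PowerSeries.map (Yangian.val : Yangian →+* ExtYangian)

theorem valY_toY (a : ExtYangian⟦X⟧) (h : ∀ n, PowerSeries.coeff n a ∈ Yangian) :
    valY (toY a h) = a := by
  ext n
  simp [valY, toY]

theorem valY_shift (c : ℂ) (a : Yangian⟦X⟧) : valY (shift c a) = shift c (valY a) :=
  map_shift _ c a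

theorem valY_smul (c : ℂ) (a : Yangian⟦X⟧) : valY (c • a) = c • valY a :=
  map_smul_series _ c a

/-- The map `a(u) ↦ a(u) ⊗ 1`. -/
def leftS : ExtYangian⟦X⟧ →+* ExtYangianSq⟦X⟧ := PowerSeries.map
  (GradedTensorProduct.includeLeft (superPart parityX) (superPart parityX) : ExtYangian →+* _)

/-- The map `a(u) ↦ 1 ⊗ a(u)`. -/
def rightS : ExtYangian⟦X⟧ →+* ExtYangianSq⟦X⟧ := PowerSeries.map
  (GradedTensorProduct.includeRight (superPart parityX) (superPart parityX) : ExtYangian →+* _)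

/-- The sign rule gives no sign as soon as one of the two factors is even. It is used with `t₁₁`, so
that `h₁` in one tensor factor commutes with everything needed in the other. -/
theorem rightS_mul_leftS (i j k l : Fin 3)
    (h : Even ((par k + par l) * (par i + par j))) :
    rightS (tSeries k l) * leftS (tSeries i j) = leftS (tSeries i j) * rightS (tSeries k l) := by
  ext n
  rw [PowerSeries.coeff_mul, PowerSeries.coeff_mul, ← Finset.Nat.sum_antidiagonal_swap]
  refine Finset.sum_congr rfl fun p _ => ?_
  have := includeRight_mul_includeLeft (superPart parityX) (superPart parityX)
    (coeff_tSeries_mem i j p.1) (coeff_tSeries_mem k l p.2)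
  rw [h.neg_one_pow, one_mul] at this
  simp only [leftS, rightS, PowerSeries.coeff_map, Prod.fst_swap, Prod.snd_swap]
  exact this

theorem commute_map_inv {G : Type*} [Ring G] (φ : ExtYangian⟦X⟧ →+* G) {x : G}
    (h : Commute x (φ h₁X)) : Commute x (φ (invSeries h₁X)) := by
  have h₁ : φ h₁X * φ (invSeries h₁X) = 1 := by rw [← map_mul, h₁X_mul_inv, map_one]
  have h₂ : φ (invSeries h₁X) * φ h₁X = 1 := by rw [← map_mul, inv_mul_h₁X, map_one]
  exact (show Commute x (↑(Units.mk _ _ h₁ h₂) : G) from h).units_inv_right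

theorem commute_right_h (i j : Fin 3) : Commute (rightS h₁X) (leftS (tSeries i j)) :=
  rightS_mul_leftS i j 0 0 (by simp [par])

theorem commute_left_h (i j : Fin 3) : Commute (leftS h₁X) (rightS (tSeries i j)) :=
  (rightS_mul_leftS 0 0 i j (by simp [par])).symm

theorem commute_right_h_eX (j : Fin 3) : Commute (rightS h₁X) (leftS (eX j)) := by
  rw [eX, map_mul]
  exact (commute_map_inv leftS (commute_right_h 0 0)).mul_right (commute_right_h 0 j)

theorem commute_left_h_fX (j : Fin 3) : Commute (leftS h₁X) (rightS (fX j)) := by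
  rw [fX, map_mul]
  exact (commute_left_h j 0).mul_right (commute_map_inv rightS (commute_left_h 0 0))

/-! ### The coproduct of the Gaussian series in `X ⊗ X`. -/

/-- The map induced by the coproduct on series. -/
def deltaX : ExtYangian⟦X⟧ →+* ExtYangianSq⟦X⟧ :=
  PowerSeries.map (coproductX : ExtYangian →+* ExtYangianSq)

theorem deltaX_tSeries (i j : Fin 3) : deltaX (tSeries i j) =
    leftS (tSeries i 0) * rightS (tSeries 0 j) + leftS (tSeries i 1) * rightS (tSeries 1 j) +
      leftS (tSeries i 2) * rightS (tSeries 2 j) := by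
  rw [deltaX, map_coproductX, Fin.sum_univ_three]
  simp only [seriesTmul_eq]
  rfl

theorem leftS_h_mul_inv : leftS h₁X * leftS (invSeries h₁X) = 1 := by
  rw [← map_mul, h₁X_mul_inv, map_one]

theorem rightS_h_mul_inv : rightS h₁X * rightS (invSeries h₁X) = 1 := by
  rw [← map_mul, h₁X_mul_inv, map_one]

theorem leftS_inv_mul_h : leftS (invSeries h₁X) * leftS h₁X = 1 := by
  rw [← map_mul, inv_mul_h₁X, map_one]

theorem rightS_inv_mul_h : rightS (invSeries h₁X) * rightS h₁X = 1 := by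
  rw [← map_mul, inv_mul_h₁X, map_one]

/-- The series `e(u) ⊗ f(u + 1) + e_{11'}(u) ⊗ (f_{1'1}(u + 1) - 2 f(u + 1)²)`, whose geometric
series enters `Δ(e(u))`. -/
def upperKernel : ExtYangianSq⟦X⟧ :=
  leftS (eX 1) * rightS (shift 1 (fX 1)) +
    leftS (eX 2) * rightS (shift 1 (fX 2) - 2 * shift 1 (fX 1) ^ 2)

/-- The series `e(u + 1) ⊗ f(u) + (e_{11'}(u + 1) + 2 e(u + 1)²) ⊗ f_{1'1}(u)`, whose geometric
series enters `Δ(f(u))`. -/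
def lowerKernel : ExtYangianSq⟦X⟧ :=
  leftS (shift 1 (eX 1)) * rightS (fX 1) +
    leftS (shift 1 (eX 2) + 2 * shift 1 (eX 1) ^ 2) * rightS (fX 2)

theorem mul_move {M : Type*} [Monoid M] {L R x y : M} (h : Commute R x) :
    L * R * (x * y) = L * x * (R * y) := by
  rw [mul_assoc, ← mul_assoc R, h.eq]; simp only [mul_assoc]

theorem move_mul {M : Type*} [Monoid M] {L R x y : M} (h : Commute L y) :
    x * y * (L * R) = x * L * (y * R) := by
  rw [mul_assoc, ← mul_assoc y, ← h.eq]; simp only [mul_assoc]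

theorem deltaX_h₁X_upper : leftS h₁X * rightS h₁X * (1 + upperKernel) = deltaX h₁X := by
  have h : deltaX h₁X = _ := deltaX_tSeries 0 0
  rw [h, upperKernel, mul_add, mul_one, mul_add, mul_move (commute_right_h_eX 1),
    mul_move (commute_right_h_eX 2)]
  simp only [← map_mul, h₁X_mul_eX, h₁X_mul_shift_f, h₁X_mul_shift_f₁₁]
  rw [add_assoc]
  rfl

/-- The factor `h₁ ⊗ h₁` is now taken out on the right, to match `f = t₂₁ h₁⁻¹`. This is why the
shifts fall on the `e` series here and on the `f` series in `deltaX_h₁X_upper`. -/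
theorem deltaX_h₁X_lower : (1 + lowerKernel) * (leftS h₁X * rightS h₁X) = deltaX h₁X := by
  have h : deltaX h₁X = _ := deltaX_tSeries 0 0
  rw [h, lowerKernel, add_mul, one_mul, add_mul, move_mul (commute_left_h_fX 1),
    move_mul (commute_left_h_fX 2)]
  simp only [← map_mul, fX_mul_h₁X, shift_e_mul_h₁X, shift_e₁₁_mul_h₁X]
  rw [add_assoc]
  rfl

/-- Multiplied by the invertible `h₁ ⊗ h₁`, both sides become `t₁₂ ⊗ h₂ + t₁₁' ⊗ (t₁'₂ - t₁'₁ e)`.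
-/
theorem deltaX_eX : (1 + upperKernel) * (deltaX (eX 1) - rightS (eX 1)) =
    (leftS (eX 1) + leftS (eX 2) *
      rightS ((1 / 3 : ℂ) • shift (-1 / 2) (fX 1) + (2 / 3 : ℂ) • shift 1 (fX 1))) *
      rightS kX := by
  have key : leftS h₁X * rightS h₁X * ((1 + upperKernel) * (deltaX (eX 1) - rightS (eX 1))) =
      leftS h₁X * rightS h₁X * ((leftS (eX 1) + leftS (eX 2) *
        rightS ((1 / 3 : ℂ) • shift (-1 / 2) (fX 1) + (2 / 3 : ℂ) • shift 1 (fX 1))) *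
        rightS kX) := by
    have h₀ : deltaX h₁X = _ := deltaX_tSeries 0 0
    rw [← mul_assoc, deltaX_h₁X_upper, mul_sub, ← map_mul, h₁X_mul_eX, deltaX_tSeries, h₀,
      add_mul (leftS (eX 1)), mul_assoc (leftS (eX 2)), mul_add, mul_move (commute_right_h_eX 1),
      mul_move (commute_right_h_eX 2)]
    simp only [← map_mul, h₁X_mul_eX]
    -- Passing `h₁` through the `1/3, 2/3` combination leaves `f(u - 1/2) h₁ k = f(u - 1/2) h₂`,
    -- which is the quasideterminant. Writing `t₁₂ = h₁ e` then lets the `h₁ ⊗ t₁₂` terms cancel.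
    rw [← mul_assoc h₁X, h₁X_mul_half_f, mul_assoc, h₁X_mul_kX, ← lower_quasidet,
      ← h₁X_mul_eX 1]
    have h₂ : h₂X = tSeries 1 1 - tSeries 1 0 * eX 1 := by
      rw [h₂X, eX, ← mul_assoc]; rfl
    rw [h₂]
    simp only [map_sub, map_mul, mul_sub, add_mul, mul_assoc]
    change leftS h₁X * (rightS h₁X * _) + _ + _ - (leftS h₁X * (rightS h₁X * _) + _ + _) = _
    abel
  have := congrArg (rightS (invSeries h₁X) * leftS (invSeries h₁X) * ·) key
  have hu : rightS (invSeries h₁X) * leftS (invSeries h₁X) * (leftS h₁X * rightS h₁X) = 1 := by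
    rw [mul_assoc, ← mul_assoc (leftS _), leftS_inv_mul_h, one_mul, rightS_inv_mul_h]
  simp only [← mul_assoc _ (leftS h₁X * rightS h₁X), hu, one_mul] at this
  exact this

/-- Multiplied on the right by `h₁ ⊗ h₁`, both sides become `h₂ ⊗ t₂₁ + (t₂₁' - f t₁₁') ⊗ t₁'₁`. The
term `t₂₁ ⊗ t₁₁` of `Δ(t₂₁)` is cancelled by `(f ⊗ 1) Δ(h₁)`. -/
theorem deltaX_fX : (deltaX (fX 1) - leftS (fX 1)) * (1 + lowerKernel) =
    leftS kX * (rightS (fX 1) -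
      leftS ((1 / 3 : ℂ) • shift (-1 / 2) (eX 1) + (2 / 3 : ℂ) • shift 1 (eX 1)) *
        rightS (fX 2)) := by
  have key : (deltaX (fX 1) - leftS (fX 1)) * (1 + lowerKernel) * (leftS h₁X * rightS h₁X) =
      leftS kX * (rightS (fX 1) -
        leftS ((1 / 3 : ℂ) • shift (-1 / 2) (eX 1) + (2 / 3 : ℂ) • shift 1 (eX 1)) *
          rightS (fX 2)) * (leftS h₁X * rightS h₁X) := by
    have h₀ : deltaX h₁X = _ := deltaX_tSeries 0 0
    have h₁ : rightS (fX 1) * (leftS h₁X * rightS h₁X) = leftS h₁X * rightS (fX 1 * h₁X) := by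
      rw [← mul_assoc, ← (commute_left_h_fX 1).eq, mul_assoc, map_mul]
    rw [mul_assoc, deltaX_h₁X_lower, sub_mul, ← map_mul, fX_mul_h₁X, deltaX_tSeries, h₀,
      mul_assoc (leftS kX), sub_mul, h₁, move_mul (commute_left_h_fX 2), mul_sub,
      ← mul_assoc (leftS kX), ← mul_assoc (leftS kX)]
    simp only [← map_mul, fX_mul_h₁X]
    rw [half_e_mul_h₁X, ← mul_assoc kX, kX_mul_h₁X,
      ← neg_neg (h₂X * shift (-1 / 2) (eX 1)), ← upper_quasidet]
    have h₂ : h₂X = tSeries 1 1 - fX 1 * tSeries 0 1 := by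
      rw [h₂X, fX]; rfl
    have h₃ : fX 1 * tSeries 0 0 = tSeries 1 0 := fX_mul_h₁X 1
    simp only [mul_add, ← mul_assoc, ← map_mul, h₃]
    rw [h₂]
    simp only [map_sub, map_neg, neg_mul, sub_mul]
    abel
  have := congrArg (· * (rightS (invSeries h₁X) * leftS (invSeries h₁X))) key
  have hu : leftS h₁X * rightS h₁X * (rightS (invSeries h₁X) * leftS (invSeries h₁X)) = 1 := by
    rw [mul_assoc, ← mul_assoc (rightS _), rightS_h_mul_inv, one_mul, leftS_h_mul_inv]
  simp only [mul_assoc _ (leftS h₁X * rightS h₁X), hu, mul_one] at this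
  exact this

/-! ### Descent from `X ⊗ X` to `Y ⊗ Y`. -/

/-- The embedding of series over `Y ⊗ Y` into those over `X ⊗ X`. -/
def inclSeries : YangianSq⟦X⟧ →+* ExtYangianSq⟦X⟧ :=
  PowerSeries.map (inclSq : YangianSq →+* ExtYangianSq)

theorem inclSeries_injective : Function.Injective inclSeries := by
  intro a b h
  ext n
  have := congrArg (PowerSeries.coeff n) h
  simp only [inclSeries, PowerSeries.coeff_map] at this
  exact inclSq_injective this

theorem inclSeries_tmulY (a b : Yangian⟦X⟧) :
    inclSeries (tmulY a b) = leftS (valY a) * rightS (valY b) := by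
  rw [inclSeries, tmulY, inclSq, map_superMap, seriesTmul_eq]
  rfl

theorem inclSeries_deltaSeries (a : Yangian⟦X⟧) : inclSeries (deltaSeries a) = deltaX (valY a) := by
  ext n
  simp only [inclSeries, deltaSeries, deltaX, valY, PowerSeries.coeff_map]
  exact inclSq_coproductY _

theorem constantCoeff_tmulY_left {a b : Yangian⟦X⟧} (h : PowerSeries.constantCoeff a = 0) :
    PowerSeries.constantCoeff (tmulY a b) = 0 := by
  rw [tmulY, seriesTmul_eq, map_mul]
  have : ∀ f : Yangian →+* YangianSq, PowerSeries.constantCoeff (PowerSeries.map f a) = 0 := by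
    intro f
    rw [← PowerSeries.coeff_zero_eq_constantCoeff_apply, PowerSeries.coeff_map,
      PowerSeries.coeff_zero_eq_constantCoeff_apply, h, map_zero]
  rw [this, zero_mul]

theorem constantCoeff_tmulY_right {a b : Yangian⟦X⟧} (h : PowerSeries.constantCoeff b = 0) :
    PowerSeries.constantCoeff (tmulY a b) = 0 := by
  rw [tmulY, seriesTmul_eq, map_mul]
  have : ∀ f : Yangian →+* YangianSq, PowerSeries.constantCoeff (PowerSeries.map f b) = 0 := by
    intro f
    rw [← PowerSeries.coeff_zero_eq_constantCoeff_apply, PowerSeries.coeff_map,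
      PowerSeries.coeff_zero_eq_constantCoeff_apply, h, map_zero]
  rw [this, mul_zero]

theorem constantCoeff_of_valY {a : Yangian⟦X⟧} {b : ExtYangian⟦X⟧} (hab : valY a = b)
    (h : PowerSeries.constantCoeff b = 0) : PowerSeries.constantCoeff a = 0 := by
  rw [← hab, ← PowerSeries.coeff_zero_eq_constantCoeff_apply, valY, PowerSeries.coeff_map] at h
  rw [← PowerSeries.coeff_zero_eq_constantCoeff_apply]
  exact Subtype.ext h

theorem constantCoeff_eX {j : Fin 3} (hj : j ≠ 0) : PowerSeries.constantCoeff (eX j) = 0 := by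
  rw [eX, map_mul, constantCoeff_tSeries, if_neg (Ne.symm hj), mul_zero]

theorem constantCoeff_fX {j : Fin 3} (hj : j ≠ 0) : PowerSeries.constantCoeff (fX j) = 0 := by
  rw [fX, map_mul, constantCoeff_tSeries, if_neg hj, zero_mul]

theorem valY_eY : valY eY = eX 1 := valY_toY _ _

theorem valY_e₁₁Y : valY e₁₁Y = eX 2 := valY_toY _ _

theorem valY_fY : valY fY = fX 1 := valY_toY _ _

theorem valY_f₁₁Y : valY f₁₁Y = fX 2 := valY_toY _ _

theorem valY_kY : valY kY = kX := valY_toY _ _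

end Transfer

end OspYangian

end

/-! ### The two coproduct formulas over `Y ⊗ Y`. -/

open OspYangian
theorem proposition4p7 :
    (∃ S : YangianSq⟦X⟧,
      HasFormalSum (fun r => (-1) ^ r *
        (tmulY eY (shift 1 fY) +
          tmulY e₁₁Y
            (shift 1 f₁₁Y - 2 * shift 1 fY ^ 2)) ^ r) S ∧
      deltaSeries eY =
        tmulY 1 eY +
          S * (tmulY eY 1 +
            tmulY e₁₁Y
              ((1 / 3 : ℂ) • shift (-1 / 2) fY +
                (2 / 3 : ℂ) • shift 1 fY)) *
            tmulY 1 kY) ∧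
    (∃ S : YangianSq⟦X⟧,
      HasFormalSum (fun r => (-1) ^ r *
        (tmulY (shift 1 eY) fY +
          tmulY
            (shift 1 e₁₁Y + 2 * shift 1 eY ^ 2)
            f₁₁Y) ^ r) S ∧
      deltaSeries fY =
        tmulY fY 1 +
          tmulY kY 1 *
            (tmulY 1 fY -
              tmulY
                ((1 / 3 : ℂ) • shift (-1 / 2) eY +
                  (2 / 3 : ℂ) • shift 1 eY) f₁₁Y) * S) := by
  constructor
  · set W := tmulY eY (shift 1 fY) + tmulY e₁₁Y (shift 1 f₁₁Y - 2 * shift 1 fY ^ 2) with hW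
    -- The left tensor factors `e` and `e₁₁'` already have no constant term, which makes the
    -- geometric series converge.
    have hW₀ : PowerSeries.constantCoeff W = 0 := by
      rw [hW, map_add,
        constantCoeff_tmulY_left (constantCoeff_of_valY valY_eY (constantCoeff_eX (by decide))),
        constantCoeff_tmulY_left (constantCoeff_of_valY valY_e₁₁Y (constantCoeff_eX (by decide))),
        add_zero]
    have h₁ : PowerSeries.constantCoeff (1 + W) = 1 := by rw [map_add, map_one, hW₀, add_zero]
    have hWX : inclSeries W = upperKernel := by
      rw [hW, map_add, inclSeries_tmulY, inclSeries_tmulY]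
      simp only [map_sub, map_mul, map_pow, map_ofNat, valY_shift, valY_eY, valY_e₁₁Y, valY_fY,
        valY_f₁₁Y, upperKernel]
    -- With the sum identified as `(1 + W)⁻¹`, the formula is equivalent to a finite identity
    -- without infinite series, which can be checked after the embedding into `X ⊗ X`.
    refine ⟨invSeries (1 + W), hasFormalSum_geometric hW₀, ?_⟩
    have key : (1 + W) * (deltaSeries eY - tmulY 1 eY) = (tmulY eY 1 + tmulY e₁₁Y
        ((1 / 3 : ℂ) • shift (-1 / 2) fY + (2 / 3 : ℂ) • shift 1 fY)) * tmulY 1 kY := by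
      apply inclSeries_injective
      simp only [map_mul inclSeries, map_add inclSeries, map_sub inclSeries, map_one inclSeries,
        inclSeries_tmulY, inclSeries_deltaSeries, hWX, map_one valY, map_one leftS, map_one rightS,
        map_add valY, valY_smul, valY_shift, valY_eY, valY_e₁₁Y, valY_fY, valY_kY, one_mul, mul_one]
      exact deltaX_eX
    rw [mul_assoc, ← key, ← mul_assoc, invSeries_mul _ h₁, one_mul, add_sub_cancel]
  · set W := tmulY (shift 1 eY) fY + tmulY (shift 1 e₁₁Y + 2 * shift 1 eY ^ 2) f₁₁Y with hW
    have hW₀ : PowerSeries.constantCoeff W = 0 := by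
      rw [hW, map_add,
        constantCoeff_tmulY_right (constantCoeff_of_valY valY_fY (constantCoeff_fX (by decide))),
        constantCoeff_tmulY_right (constantCoeff_of_valY valY_f₁₁Y (constantCoeff_fX (by decide))),
        add_zero]
    have h₁ : PowerSeries.constantCoeff (1 + W) = 1 := by rw [map_add, map_one, hW₀, add_zero]
    have hWX : inclSeries W = lowerKernel := by
      rw [hW, map_add, inclSeries_tmulY, inclSeries_tmulY]
      simp only [map_add, map_mul, map_pow, map_ofNat, valY_shift, valY_eY, valY_e₁₁Y, valY_fY,
        valY_f₁₁Y, lowerKernel]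
    refine ⟨invSeries (1 + W), hasFormalSum_geometric hW₀, ?_⟩
    have key : (deltaSeries fY - tmulY fY 1) * (1 + W) = tmulY kY 1 * (tmulY 1 fY - tmulY
        ((1 / 3 : ℂ) • shift (-1 / 2) eY + (2 / 3 : ℂ) • shift 1 eY) f₁₁Y) := by
      apply inclSeries_injective
      simp only [map_mul inclSeries, map_add inclSeries, map_sub inclSeries, map_one inclSeries,
        inclSeries_tmulY, inclSeries_deltaSeries, hWX, map_one valY, map_one leftS, map_one rightS,
        map_add valY, valY_smul, valY_shift, valY_eY, valY_f₁₁Y, valY_fY, valY_kY, one_mul, mul_one]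
      exact deltaX_fX
    rw [← key, mul_assoc, mul_invSeries _ h₁, mul_one, add_sub_cancel]
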